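/- Let $A$ be a ring, regarded as a dg algebra concentrated in cohomological degree $0$ with zero differential; dg modules over $A$ are then cochain complexes of left $A$-modules. Call an object $M$ of an additive category with arbitrary direct sums compact if $\bigoplus_{i\in I}\mathrm{Hom}(M,N_i)\to\mathrm{Hom}(M,\bigoplus_{i\in I}N_i)$ is an isomorphism for every family $(N_i)_{i\in I}$ of objects indexed by a set. (1) Suppose $A$ is left Noetherian. Let $K_0^{dg}(A)$ be the Grothendieck group of the category of compact objects of the derived category $D(A)$ of dg $A$-modules: the abelian group with generators $[M]$, over compact objects $M$, and relations $[M_2]=[M_1]+[M_3]$ for each distinguished triangle $M_1\to M_2\to M_3\to M_1[1]$ of compact objects, and $[M[1]]=-[M]$. Let $K_0(A)$ be the classical Grothendieck group of finitely generated projective left $A$-modules: generators $[P]$, relations $[P]=[P']+[P'']$ whenever $P\cong P'\oplus P''$. Then every finitely generated projective module $P$, placed in cohomological degree $0$, is compact in $D(A)$, and $[P]\mapsto[P]$ defines an isomorphism of abelian groups $K_0(A)\cong K_0^{dg}(A)$. (2) Suppose $A=\bigoplus_{i\in\mathbb Z}A_i$ is a $\mathbb Z$-graded ring which is left graded Noetherian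 (every homogeneous left ideal is finitely generated). Let $D(A)$ be the derived category of graded dg $A$-modules, that is, of cochain complexes of graded left $A$-modules with degree-preserving differentials, and let $\{n\}$ be the shift of the internal grading by $n$ degrees up, $(M\{n\})_k=M_{k-n}$. Let $K_0^{dg}(A)$ be the $\mathbb Z[q,q^{-1}]$-module with generators $[M]$, over compact objects $M$ of $D(A)$, and relations $[M_2]=[M_1]+[M_3]$ for each distinguished triangle $M_1\to M_2\to M_3\to M_1[1]$ of compact objects, $[M[1]]=-[M]$, and $[M\{n\}]=q^n[M]$. Let $K_0(A)$ be the $\mathbb Z[q,q^{-1}]$-module with generators $[P]$, over finitely generated graded projective left $A$-modules $P$, and relations $[P]=[P']+[P'']$ whenever $P\cong P'\oplus P''$ as graded modules, and $[P\{n\}]=q^n[P]$. Then every finitely generated graded projective module $P$, placed in cohomological degree $0$, is compact in $D(A)$, and $[P]\mapsto[P]$ defines an isomorphism of $\mathbb Z[q,q^{-1}]$-modules $K_0(A)\cong K_0^{dg}(A)$. -/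

import Mathlib

open CategoryTheory Limits Pretriangulated
open scoped LaurentPolynomial

universe w t u

/-! ### The category of graded left modules over a `ℤ`-graded ring -/

/-- An additive group with candidate components `gr` and projections onto them is the internal
direct sum of the `gr i`. -/
theorem isInternal_of_proj {M : Type*} [AddCommGroup M] (gr : ℤ → AddSubgroup M)
    (π : ℤ → M →+ M) (h1 : ∀ i, ∀ m ∈ gr i, π i m = m)
    (h2 : ∀ i j, i ≠ j → ∀ m ∈ gr j, π i m = 0) (h3 : ∀ m, m ∈ ⨆ i, gr i) :
    DirectSum.IsInternal gr := by
  classical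
  constructor
  · rw [injective_iff_map_eq_zero]
    intro x hx
    have key : ∀ i (y : DirectSum ℤ fun i => gr i),
        π i (DirectSum.coeAddMonoidHom gr y) = y i := by
      intro i y
      induction y using DirectSum.induction_on with
      | zero => simp
      | of j m =>
        rw [DirectSum.coeAddMonoidHom_of]
        by_cases h : i = j
        · subst h; rw [h1 _ _ m.2, DirectSum.of_eq_same]
        · rw [h2 _ _ h _ m.2, DirectSum.of_eq_of_ne _ _ _ h]; rfl
      | add a b ha hb => simp only [map_add, ha, hb, DirectSum.add_apply, AddSubgroup.coe_add]
    ext i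
    rw [← key i x, show DirectSum.coeAddMonoidHom gr x = 0 from hx]; simp
  · intro m
    have : (⨆ i, gr i) ≤ (DirectSum.coeAddMonoidHom gr).range := by
      refine iSup_le fun i m hm => ⟨DirectSum.of (fun i => gr i) i ⟨m, hm⟩, ?_⟩
      rw [DirectSum.coeAddMonoidHom_of]
    exact this (h3 m)

/-- A graded left module over the graded ring `A = ⨁ 𝒜 i`: a left `A`-module `M` which is the
internal direct sum of additive subgroups `gr j`, with `𝒜 i • gr j ⊆ gr (i + j)`. -/
structure GrMod {A : Type u} [Ring A] (𝒜 : ℤ → AddSubgroup A) : Type (u + 1) where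
  carrier : Type u
  [isAddCommGroup : AddCommGroup carrier]
  [isModule : Module A carrier]
  gr : ℤ → AddSubgroup carrier
  isInternal : DirectSum.IsInternal gr
  smul_mem : ∀ {i j : ℤ} {a : A} {m : carrier}, a ∈ 𝒜 i → m ∈ gr j → a • m ∈ gr (i + j)

namespace GrMod

attribute [instance] isAddCommGroup isModule

variable {A : Type u} [Ring A] {𝒜 : ℤ → AddSubgroup A}

/-- Morphisms of graded modules: `A`-linear maps preserving degrees. -/
@[ext]
structure Hom (M N : GrMod 𝒜) where
  lin : M.carrier →ₗ[A] N.carrier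
  map_mem : ∀ (i : ℤ) (m : M.carrier), m ∈ M.gr i → lin m ∈ N.gr i

instance : Category (GrMod 𝒜) where
  Hom M N := Hom M N
  id M := ⟨LinearMap.id, fun _ _ h => h⟩
  comp f g := ⟨g.lin ∘ₗ f.lin, fun i m h => g.map_mem i _ (f.map_mem i m h)⟩

@[ext]
theorem hom_ext {M N : GrMod 𝒜} {f g : M ⟶ N} (h : ∀ m, f.lin m = g.lin m) : f = g :=
  Hom.ext (LinearMap.ext h)

@[simp] theorem id_lin (M : GrMod 𝒜) : Hom.lin (𝟙 M) = LinearMap.id := rfl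

@[simp] theorem comp_lin {M N K : GrMod 𝒜} (f : M ⟶ N) (g : N ⟶ K) :
    (f ≫ g).lin = g.lin ∘ₗ f.lin := rfl

section Preadditive

variable (M N : GrMod 𝒜)

instance : Zero (M ⟶ N) := ⟨⟨0, fun i _ _ => (N.gr i).zero_mem⟩⟩
instance : Add (M ⟶ N) :=
  ⟨fun f g => ⟨f.lin + g.lin, fun i m h => (N.gr i).add_mem (f.map_mem i m h) (g.map_mem i m h)⟩⟩
instance : Neg (M ⟶ N) := ⟨fun f => ⟨-f.lin, fun i m h => (N.gr i).neg_mem (f.map_mem i m h)⟩⟩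
instance : Sub (M ⟶ N) :=
  ⟨fun f g => ⟨f.lin - g.lin, fun i m h => (N.gr i).sub_mem (f.map_mem i m h) (g.map_mem i m h)⟩⟩
instance : SMul ℕ (M ⟶ N) :=
  ⟨fun n f => ⟨n • f.lin, fun i m h => (N.gr i).nsmul_mem (f.map_mem i m h) n⟩⟩
instance : SMul ℤ (M ⟶ N) :=
  ⟨fun n f => ⟨n • f.lin, fun i m h => (N.gr i).zsmul_mem (f.map_mem i m h) n⟩⟩

theorem lin_injective : Function.Injective (fun f : M ⟶ N => f.lin) := fun _ _ h => Hom.ext h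

instance : AddCommGroup (M ⟶ N) :=
  (lin_injective M N).addCommGroup _ rfl (fun _ _ => rfl) (fun _ => rfl) (fun _ _ => rfl)
    (fun _ _ => rfl) (fun _ _ => rfl)

end Preadditive

@[simp] theorem zero_lin (M N : GrMod 𝒜) : (0 : M ⟶ N).lin = 0 := rfl
@[simp] theorem add_lin {M N : GrMod 𝒜} (f g : M ⟶ N) : (f + g).lin = f.lin + g.lin := rfl

instance : Preadditive (GrMod 𝒜) where
  add_comp _ _ _ f f' g := by ext m; exact map_add g.lin _ _
  comp_add _ _ _ f g g' := by ext m; rfl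

/-! Homogeneous components -/

/-- The projection of a graded module onto its component of degree `i`. -/
noncomputable def proj (M : GrMod 𝒜) (i : ℤ) : M.carrier →+ M.carrier :=
  letI := M.isInternal.chooseDecomposition
  ((M.gr i).subtype.comp (DFinsupp.evalAddMonoidHom i)).comp
    (DirectSum.decomposeAddEquiv M.gr).toAddMonoidHom

theorem proj_mem (M : GrMod 𝒜) (i : ℤ) (m : M.carrier) : M.proj i m ∈ M.gr i :=
  Subtype.property _

theorem proj_of_mem (M : GrMod 𝒜) {i : ℤ} {m : M.carrier} (h : m ∈ M.gr i) : M.proj i m = m :=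
  letI := M.isInternal.chooseDecomposition
  DirectSum.decompose_of_mem_same M.gr h

theorem proj_of_mem_ne (M : GrMod 𝒜) {i j : ℤ} (hij : i ≠ j) {m : M.carrier} (h : m ∈ M.gr j) :
    M.proj i m = 0 :=
  letI := M.isInternal.chooseDecomposition
  DirectSum.decompose_of_mem_ne M.gr h hij.symm

theorem exists_sum (M : GrMod 𝒜) (m : M.carrier) : ∃ s : Finset ℤ, ∑ i ∈ s, M.proj i m = m := by
  classical
  let := M.isInternal.chooseDecomposition
  exact ⟨_, DirectSum.sum_support_decompose M.gr m⟩

@[elab_as_elim]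
theorem induction_gr (M : GrMod 𝒜) {p : M.carrier → Prop} (h0 : p 0)
    (h : ∀ i, ∀ m ∈ M.gr i, p m) (ha : ∀ m n, p m → p n → p (m + n)) (m : M.carrier) : p m := by
  classical
  obtain ⟨s, hs⟩ := M.exists_sum m
  rw [← hs]
  exact Finset.sum_induction _ p ha h0 fun i _ => h i _ (M.proj_mem i m)

theorem proj_naturality {M N : GrMod 𝒜} (f : M ⟶ N) (i : ℤ) (m : M.carrier) :
    N.proj i (f.lin m) = f.lin (M.proj i m) := by
  induction m using M.induction_gr with
  | h0 => simp
  | h j m hm =>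
    by_cases hij : i = j
    · subst hij; rw [M.proj_of_mem hm, N.proj_of_mem (f.map_mem _ _ hm)]
    · rw [M.proj_of_mem_ne hij hm, N.proj_of_mem_ne hij (f.map_mem _ _ hm), map_zero]
  | ha a b ha hb => simp [ha, hb]

/-! Kernels, cokernels and biproducts -/

/-- The kernel of a morphism, graded by the intersections with the components. -/
noncomputable def ker {M N : GrMod 𝒜} (f : M ⟶ N) : GrMod 𝒜 where
  carrier := LinearMap.ker f.lin
  gr i := (M.gr i).comap (LinearMap.ker f.lin).subtype.toAddMonoidHom
  isInternal := by
    have hk : ∀ i (m : LinearMap.ker f.lin), M.proj i m ∈ LinearMap.ker f.lin := by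
      intro i m
      rw [LinearMap.mem_ker, ← proj_naturality, LinearMap.mem_ker.1 m.2, map_zero]
    refine isInternal_of_proj _
      (fun i => AddMonoidHom.mk' (fun m => ⟨M.proj i m, hk i m⟩) fun a b => Subtype.ext (by simp))
      ?_ ?_ ?_
    · intro i m hm; exact Subtype.ext (M.proj_of_mem hm)
    · intro i j hij m hm; exact Subtype.ext (M.proj_of_mem_ne hij hm)
    · intro m
      obtain ⟨s, hs⟩ := M.exists_sum m
      have : m = ∑ i ∈ s, (⟨M.proj i m, hk i m⟩ : LinearMap.ker f.lin) :=
        Subtype.ext (by simpa using hs.symm)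
      rw [this]
      exact sum_mem fun i _ => AddSubgroup.mem_iSup_of_mem i (M.proj_mem i m)
  smul_mem ha hm := M.smul_mem ha hm

/-- The inclusion of the kernel. -/
noncomputable def kerι {M N : GrMod 𝒜} (f : M ⟶ N) : ker f ⟶ M :=
  ⟨(LinearMap.ker f.lin).subtype, fun _ _ h => h⟩

/-- The universal property of the kernel. -/
noncomputable def kerIsLimit {M N : GrMod 𝒜} (f : M ⟶ N) :
    IsLimit (KernelFork.ofι (f := f) (kerι f) (by ext m; exact m.2)) :=
  KernelFork.IsLimit.ofι _ _
    (fun {W} g hg => ⟨g.lin.codRestrict _ fun x =>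
      LinearMap.mem_ker.2 (LinearMap.congr_fun (congrArg Hom.lin hg) x), fun i x hx =>
        g.map_mem i x hx⟩)
    (fun _ _ => rfl)
    (fun {W} g hg k hk => by
      ext x; exact Subtype.ext (LinearMap.congr_fun (congrArg Hom.lin hk) x))

/-- The cokernel of a morphism, graded by the images of the components. -/
noncomputable def coker {M N : GrMod 𝒜} (f : M ⟶ N) : GrMod 𝒜 where
  carrier := N.carrier ⧸ LinearMap.range f.lin
  gr i := (N.gr i).map (LinearMap.range f.lin).mkQ.toAddMonoidHom
  isInternal := by
    refine isInternal_of_proj _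
      (fun i => QuotientAddGroup.map (LinearMap.range f.lin).toAddSubgroup
        (LinearMap.range f.lin).toAddSubgroup (N.proj i) ?_) ?_ ?_ ?_
    · rintro _ ⟨m, rfl⟩
      exact ⟨M.proj i m, (proj_naturality f i m).symm⟩
    · rintro i _ ⟨m, hm, rfl⟩
      exact congrArg (LinearMap.range f.lin).mkQ (N.proj_of_mem hm)
    · rintro i j hij _ ⟨m, hm, rfl⟩
      exact (congrArg (LinearMap.range f.lin).mkQ (N.proj_of_mem_ne hij hm)).trans (map_zero _)
    · intro m
      obtain ⟨m, rfl⟩ := (LinearMap.range f.lin).mkQ_surjective m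
      induction m using N.induction_gr with
      | h0 => simp
      | h i m hm => exact AddSubgroup.mem_iSup_of_mem i ⟨m, hm, rfl⟩
      | ha a b ha hb => rw [map_add]; exact add_mem ha hb
  smul_mem := by
    rintro i j a _ ha ⟨m, hm, rfl⟩
    exact ⟨a • m, N.smul_mem ha hm, map_smul (LinearMap.range f.lin).mkQ a m⟩

/-- The projection to the cokernel. -/
noncomputable def cokerπ {M N : GrMod 𝒜} (f : M ⟶ N) : N ⟶ coker f :=
  ⟨(LinearMap.range f.lin).mkQ, fun _ m h => ⟨m, h, rfl⟩⟩

theorem comp_cokerπ {M N : GrMod 𝒜} (f : M ⟶ N) : f ≫ cokerπ f = 0 := by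
  ext m
  exact (Submodule.Quotient.mk_eq_zero _).2 ⟨m, rfl⟩

/-- The universal property of the cokernel. -/
noncomputable def cokerIsColimit {M N : GrMod 𝒜} (f : M ⟶ N) :
    IsColimit (CokernelCofork.ofπ (f := f) (cokerπ f) (comp_cokerπ f)) :=
  CokernelCofork.IsColimit.ofπ _ _
    (fun {W} g hg => ⟨(LinearMap.range f.lin).liftQ g.lin (by
        rintro _ ⟨m, rfl⟩
        exact LinearMap.congr_fun (congrArg Hom.lin hg) m), by
      rintro i _ ⟨m, hm, rfl⟩
      exact g.map_mem i m hm⟩)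
    (fun _ _ => rfl)
    (fun {W} g hg k hk => by
      ext x
      obtain ⟨x, rfl⟩ := (LinearMap.range f.lin).mkQ_surjective x
      exact LinearMap.congr_fun (congrArg Hom.lin hk) x)

instance : HasKernels (GrMod 𝒜) := ⟨fun f => ⟨⟨⟨_, kerIsLimit f⟩⟩⟩⟩
instance : HasCokernels (GrMod 𝒜) := ⟨fun f => ⟨⟨⟨_, cokerIsColimit f⟩⟩⟩⟩

/-- The direct sum of two graded modules. -/
def prod (M N : GrMod 𝒜) : GrMod 𝒜 where
  carrier := M.carrier × N.carrier
  gr i := (M.gr i).prod (N.gr i)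
  isInternal := by
    refine isInternal_of_proj _ (fun i => (M.proj i).prodMap (N.proj i)) ?_ ?_ ?_
    · rintro i m ⟨h1, h2⟩; exact Prod.ext (M.proj_of_mem h1) (N.proj_of_mem h2)
    · rintro i j hij m ⟨h1, h2⟩
      exact Prod.ext (M.proj_of_mem_ne hij h1) (N.proj_of_mem_ne hij h2)
    · rintro ⟨m, n⟩
      have : ((m, n) : M.carrier × N.carrier) = (m, 0) + (0, n) := by simp
      rw [this]
      refine add_mem ?_ ?_
      · clear this
        induction m using M.induction_gr with
        | h0 => exact zero_mem _
        | h i m hm => exact AddSubgroup.mem_iSup_of_mem i ⟨hm, zero_mem _⟩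
        | ha a b ha hb =>
          rw [show ((a + b, 0) : M.carrier × N.carrier) = (a, 0) + (b, 0) by simp]
          exact add_mem ha hb
      · clear this
        induction n using N.induction_gr with
        | h0 => exact zero_mem _
        | h i m hm => exact AddSubgroup.mem_iSup_of_mem i ⟨zero_mem _, hm⟩
        | ha a b ha hb =>
          rw [show ((0, a + b) : M.carrier × N.carrier) = (0, a) + (0, b) by simp]
          exact add_mem ha hb
  smul_mem ha hm := ⟨M.smul_mem ha hm.1, N.smul_mem ha hm.2⟩

instance : HasBinaryBiproducts (GrMod 𝒜) where
  has_binary_biproduct M N := hasBinaryBiproduct_of_total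
    { pt := prod M N
      fst := ⟨LinearMap.fst A _ _, fun _ _ h => h.1⟩
      snd := ⟨LinearMap.snd A _ _, fun _ _ h => h.2⟩
      inl := ⟨LinearMap.inl A _ _, fun _ _ h => ⟨h, zero_mem _⟩⟩
      inr := ⟨LinearMap.inr A _ _, fun _ _ h => ⟨zero_mem _, h⟩⟩
      inl_fst := rfl
      inl_snd := rfl
      inr_fst := rfl
      inr_snd := rfl } (by
        ext m
        exact Prod.ext (add_zero _) (zero_add _))

/-- The zero module. -/
def zeroObj : GrMod 𝒜 where
  carrier := PUnit
  gr _ := ⊤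
  isInternal := isInternal_of_proj _ (fun _ => 0) (fun _ _ _ => rfl) (fun _ _ _ _ _ => rfl)
    (fun _ => AddSubgroup.mem_iSup_of_mem 0 trivial)
  smul_mem _ _ := trivial

instance : HasZeroObject (GrMod 𝒜) :=
  ⟨zeroObj, (IsZero.iff_id_eq_zero _).2 (by ext m; rfl)⟩

instance : HasFiniteProducts (GrMod 𝒜) :=
  haveI : HasTerminal (GrMod 𝒜) := HasZeroObject.hasTerminal
  hasFiniteProducts_of_has_binary_and_terminal

theorem injective_of_mono {M N : GrMod 𝒜} (f : M ⟶ N) [Mono f] : Function.Injective f.lin := by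
  have h : kerι f = 0 := by
    rw [← cancel_mono f, zero_comp]; ext m; exact m.2
  rw [← LinearMap.ker_eq_bot, eq_bot_iff]
  intro m hm
  exact LinearMap.congr_fun (congrArg Hom.lin h) ⟨m, hm⟩

theorem surjective_of_epi {M N : GrMod 𝒜} (f : M ⟶ N) [Epi f] : Function.Surjective f.lin := by
  have h : cokerπ f = 0 := by
    rw [← cancel_epi f, comp_cokerπ, comp_zero]
  intro n
  exact (Submodule.Quotient.mk_eq_zero _).1 (LinearMap.congr_fun (congrArg Hom.lin h) n)

/-- A monomorphism is the kernel of its cokernel. -/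
@[reducible]
noncomputable def normalMono {M N : GrMod 𝒜} (f : M ⟶ N) [Mono f] : NormalMono f where
  Z := coker f
  g := cokerπ f
  w := comp_cokerπ f
  isLimit := by
    have hf := injective_of_mono f
    have hr : ∀ {W : GrMod 𝒜} (g : W ⟶ N), g ≫ cokerπ f = 0 → ∀ x, g.lin x ∈ LinearMap.range f.lin :=
      fun g hg x => (Submodule.Quotient.mk_eq_zero _).1
        (LinearMap.congr_fun (congrArg Hom.lin hg) x)
    let e := LinearEquiv.ofInjective f.lin hf
    have he : ∀ y, f.lin (e.symm y) = y := fun y => congrArg Subtype.val (e.apply_symm_apply y)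
    refine KernelFork.IsLimit.ofι _ _
      (fun {W} g hg => ⟨e.symm.toLinearMap ∘ₗ g.lin.codRestrict _ (hr g hg), ?_⟩) ?_ ?_
    · intro i x hx
      have hy := he ⟨g.lin x, hr g hg x⟩
      have : e.symm ⟨g.lin x, hr g hg x⟩ = M.proj i (e.symm ⟨g.lin x, hr g hg x⟩) := by
        apply hf
        rw [← proj_naturality, hy, N.proj_of_mem (g.map_mem i x hx)]
      change e.symm ⟨g.lin x, hr g hg x⟩ ∈ M.gr i
      rw [this]
      exact M.proj_mem _ _
    · intro W g hg
      ext x; exact he ⟨g.lin x, hr g hg x⟩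
    · intro W g hg k hk
      rw [← cancel_mono f, hk]
      ext x; exact (he ⟨g.lin x, hr g hg x⟩).symm

/-- An epimorphism is the cokernel of its kernel. -/
@[reducible]
noncomputable def normalEpi {M N : GrMod 𝒜} (f : M ⟶ N) [Epi f] : NormalEpi f where
  W := ker f
  g := kerι f
  w := by ext m; exact m.2
  isColimit := by
    have hf := surjective_of_epi f
    let e := f.lin.quotKerEquivOfSurjective hf
    have he : ∀ x, e.symm (f.lin x) = (LinearMap.ker f.lin).mkQ x := fun x => by
      rw [LinearEquiv.symm_apply_eq]; rfl
    have hk : ∀ {W : GrMod 𝒜} (g : M ⟶ W), kerι f ≫ g = 0 →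
        LinearMap.ker f.lin ≤ LinearMap.ker g.lin := fun g hg x hx =>
      LinearMap.congr_fun (congrArg Hom.lin hg) ⟨x, hx⟩
    refine CokernelCofork.IsColimit.ofπ _ _
      (fun {W} g hg => ⟨(LinearMap.ker f.lin).liftQ g.lin (hk g hg) ∘ₗ e.symm.toLinearMap, ?_⟩)
      ?_ ?_
    · intro i y hy
      obtain ⟨x, rfl⟩ := hf y
      have : f.lin x = f.lin (M.proj i x) := by rw [← proj_naturality, N.proj_of_mem hy]
      rw [this]
      change (LinearMap.ker f.lin).liftQ g.lin (hk g hg) (e.symm (f.lin (M.proj i x))) ∈ W.gr i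
      rw [he]
      exact g.map_mem i _ (M.proj_mem i x)
    · intro W g hg
      ext x
      change (LinearMap.ker f.lin).liftQ g.lin (hk g hg) (e.symm (f.lin x)) = g.lin x
      rw [he]; rfl
    · intro W g hg k hk'
      rw [← cancel_epi f, hk']
      ext x
      change _ = (LinearMap.ker f.lin).liftQ g.lin (hk g hg) (e.symm (f.lin x))
      rw [he]; rfl

noncomputable instance : Abelian (GrMod 𝒜) where
  normalMonoOfMono f _ := ⟨normalMono f⟩
  normalEpiOfEpi f _ := ⟨normalEpi f⟩
  has_finite_products := inferInstance

/-! The grading shift -/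

/-- The grading shift `M ↦ M{n}` by `n` degrees up: `(M{n})_k = M_{k - n}`. -/
def shiftObj (n : ℤ) (M : GrMod 𝒜) : GrMod 𝒜 where
  carrier := M.carrier
  gr k := M.gr (k - n)
  isInternal := by
    refine isInternal_of_proj _ (fun k => M.proj (k - n)) (fun i m hm => M.proj_of_mem hm)
      (fun i j hij m hm => M.proj_of_mem_ne (by omega) hm) fun m => ?_
    induction m using M.induction_gr with
    | h0 => exact zero_mem _
    | h i m hm => exact AddSubgroup.mem_iSup_of_mem (i + n) (by simpa using hm)
    | ha a b ha hb => exact add_mem ha hb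
  smul_mem {i j a m} ha hm := by
    have := M.smul_mem ha hm
    rwa [show i + j - n = i + (j - n) by ring]

/-- The grading shift as a functor. -/
def shift (𝒜 : ℤ → AddSubgroup A) (n : ℤ) : GrMod 𝒜 ⥤ GrMod 𝒜 where
  obj M := shiftObj n M
  map f := ⟨f.lin, fun k m h => f.map_mem (k - n) m h⟩

instance (n : ℤ) : (shift 𝒜 n).Additive where

instance (n : ℤ) : (shift 𝒜 n).Faithful where
  map_injective {M N} f g h := by
    have h' : ((shift 𝒜 n).map f).lin = ((shift 𝒜 n).map g).lin := congrArg Hom.lin h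
    exact Hom.ext h'

instance (n : ℤ) : (shift 𝒜 n).Full where
  map_surjective {M N} f := ⟨⟨f.lin, fun k m h => by
    have := f.map_mem (k + n) m (show m ∈ M.gr (k + n - n) by simpa using h)
    have h' : f.lin m ∈ N.gr (k + n - n) := this
    have hk : k + n - n = k := by ring
    rwa [hk] at h'⟩, rfl⟩

instance (n : ℤ) : (shift 𝒜 n).EssSurj where
  mem_essImage M := by
    have h : ∀ k, k - n - -n = k := fun k => by ring
    refine ⟨shiftObj (-n) M, ⟨⟨⟨LinearMap.id, fun k m hm => ?_⟩, ⟨LinearMap.id, fun k m hm => ?_⟩,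
      rfl, rfl⟩⟩⟩
    · have hm' : m ∈ M.gr (k - n - -n) := hm
      rwa [h] at hm'
    · change m ∈ M.gr (k - n - -n)
      rwa [h]

instance (n : ℤ) : (shift 𝒜 n).IsEquivalence where

end GrMod

/-- A graded ring is (left) graded Noetherian if all its homogeneous left ideals are finitely
generated. -/
def IsGradedNoetherian {A : Type u} [Ring A] (𝒜 : ℤ → AddSubgroup A) [GradedRing 𝒜] : Prop :=
  ∀ I : Ideal A, I.IsHomogeneous 𝒜 → I.FG

/-! ### Compact objects and Grothendieck groups -/

open Classical in
/-- `M` is compact if `⨁ Hom(M, N i) → Hom(M, ⨁ N i)` is an isomorphism for every family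
`(N i)_{i ∈ I}` of objects; here `c` is the direct sum (coproduct) of the family. -/
def isCompactObject (D : Type*) [Category* D] [Preadditive D] : ObjectProperty D := fun M =>
  ∀ (I : Type t) (N : I → D) (c : Cofan N), Nonempty (IsColimit c) →
    Function.Bijective
      (DirectSum.toAddMonoid (fun i => Preadditive.rightComp M (c.inj i)) :
        (DirectSum I fun i => (M ⟶ N i)) →+ (M ⟶ c.pt))

section Relations

variable (R : Type) [Ring R]

/-- The relations `[X₂] = [X₁] + [X₃]`, one for each distinguished triangle
`X₁ ⟶ X₂ ⟶ X₃ ⟶ X₁⟦1⟧` of objects of the full subcategory `P`, and `[X⟦1⟧] = -[X]`. -/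
def triangleRelations {D : Type*} [Category* D] [Preadditive D] [HasZeroObject D] [HasShift D ℤ]
    [∀ n : ℤ, (shiftFunctor D n).Additive] [Pretriangulated D] (P : ObjectProperty D) :
    Set (P.FullSubcategory →₀ R) :=
  {r | ∃ T ∈ distTriang D, ∃ (h₁ : P T.obj₁) (h₂ : P T.obj₂) (h₃ : P T.obj₃),
    r = .single ⟨T.obj₂, h₂⟩ 1 - .single ⟨T.obj₁, h₁⟩ 1 - .single ⟨T.obj₃, h₃⟩ 1} ∪
  {r | ∃ (X : D) (h : P X) (h' : P (X⟦(1 : ℤ)⟧)), r = .single ⟨X⟦(1 : ℤ)⟧, h'⟩ 1 + .single ⟨X, h⟩ 1}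

/-- The relations `[X] = [Y] + [Z]` for `X ≅ Y ⊕ Z`, where `X`, `Y`, `Z` are objects of the full
subcategory `P` of an additive category. -/
def directSumRelations {C : Type*} [Category* C] [Preadditive C] [HasBinaryBiproducts C]
    (P : ObjectProperty C) : Set (P.FullSubcategory →₀ R) :=
  {r | ∃ X Y Z : P.FullSubcategory, Nonempty (X.obj ≅ Y.obj ⊞ Z.obj) ∧
    r = .single X 1 - .single Y 1 - .single Z 1}

/-- The relations `[X{n}] = q ^ n [X]` over `ℤ[q, q⁻¹]`, for a family of functors
`S n : X ↦ X{n}`; they are imposed for all objects of `P` isomorphic to `X{n}`. -/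
def shiftRelations {C : Type*} [Category* C] (P : ObjectProperty C) (S : ℤ → C ⥤ C) :
    Set (P.FullSubcategory →₀ ℤ[T;T⁻¹]) :=
  {r | ∃ (n : ℤ) (X Y : P.FullSubcategory), Nonempty (Y.obj ≅ (S n).obj X.obj) ∧
    r = .single Y 1 - .single X (LaurentPolynomial.T n)}

end Relations

/-! ### The ungraded case: an ordinary ring `A`

A dg module over `A`, placed in cohomological degree `0` with zero differential, is a family of
`A`-modules `M^i` with `A`-linear differentials `d : M^i ⟶ M^{i+1}`, `d ∘ d = 0`, that is, a cochain
complex of `A`-modules.  So the derived category of dg modules over `A` is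
`DerivedCategory (ModuleCat A)`, the localization of `CochainComplex (ModuleCat A) ℤ` at the
quasi-isomorphisms. -/

section Ungraded

variable (A : Type u) [Ring A]

/-- Finitely generated projective left `A`-modules. -/
def fgProjective : ObjectProperty (ModuleCat.{u} A) := fun M =>
  Module.Finite A M ∧ Module.Projective A M

/-- The classical `K₀` of `A`. -/
abbrev ClassicalK0 : Type (u + 1) :=
  ((fgProjective A).FullSubcategory →₀ ℤ) ⧸
    Submodule.span ℤ (directSumRelations ℤ (fgProjective A))

/-- The class `[P]` of a finitely generated projective module. -/
noncomputable def ClassicalK0.mk (P : (fgProjective A).FullSubcategory) : ClassicalK0 A :=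
  Submodule.Quotient.mk (.single P 1)

variable [HasDerivedCategory.{w} (ModuleCat.{u} A)]

/-- Compact objects of the derived category of dg modules over `A`. -/
abbrev compactDg : ObjectProperty (DerivedCategory (ModuleCat.{u} A)) := isCompactObject.{u} _

/-- The Grothendieck group of the triangulated category of compact objects of the derived category
of dg modules over `A`. -/
abbrev DgK0 : Type (u + 1) :=
  ((compactDg A).FullSubcategory →₀ ℤ) ⧸ Submodule.span ℤ (triangleRelations ℤ (compactDg A))

/-- The class `[M]` of a compact object. -/
noncomputable def DgK0.mk (M : (compactDg A).FullSubcategory) : DgK0 A :=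
  Submodule.Quotient.mk (.single M 1)

end Ungraded

/-! ### The graded case: a `ℤ`-graded ring `A`

In the same way, a graded dg module over the graded ring `A`, placed in cohomological degree `0`
with zero differential, is a cochain complex of graded `A`-modules (with differentials preserving
the `q`-grading), and the derived category of graded dg modules is `DerivedCategory (GrMod 𝒜)`. -/

section Graded

variable {A : Type u} [Ring A] (𝒜 : ℤ → AddSubgroup A)

/-- Finitely generated graded projective left `A`-modules: finitely generated as `A`-modules, and
projective as `A`-modules. -/
def grFgProjective : ObjectProperty (GrMod 𝒜) := fun M =>
  Module.Finite A M.carrier ∧ Module.Projective A M.carrier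

/-- The classical `K₀` of the graded ring `A`, a `ℤ[q, q⁻¹]`-module. -/
abbrev GrClassicalK0 : Type (u + 1) :=
  ((grFgProjective 𝒜).FullSubcategory →₀ ℤ[T;T⁻¹]) ⧸
    Submodule.span ℤ[T;T⁻¹] (directSumRelations ℤ[T;T⁻¹] (grFgProjective 𝒜) ∪
      shiftRelations (grFgProjective 𝒜) (GrMod.shift 𝒜))

/-- The class `[P]` of a finitely generated graded projective module. -/
noncomputable def GrClassicalK0.mk (P : (grFgProjective 𝒜).FullSubcategory) : GrClassicalK0 𝒜 :=
  Submodule.Quotient.mk (.single P 1)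

variable [HasDerivedCategory.{w} (GrMod 𝒜)]

/-- Compact objects of the derived category of graded dg modules over `A`. -/
abbrev compactGrDg : ObjectProperty (DerivedCategory (GrMod 𝒜)) := isCompactObject.{u} _

/-- The Grothendieck group of the triangulated category of compact objects of the derived category
of graded dg modules over `A`, a `ℤ[q, q⁻¹]`-module with `q` acting by the shift of the
`q`-grading. -/
abbrev GrDgK0 : Type (u + 1) :=
  ((compactGrDg 𝒜).FullSubcategory →₀ ℤ[T;T⁻¹]) ⧸
    Submodule.span ℤ[T;T⁻¹] (triangleRelations ℤ[T;T⁻¹] (compactGrDg 𝒜) ∪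
      shiftRelations (compactGrDg 𝒜) fun n => (GrMod.shift 𝒜 n).mapDerivedCategory)

/-- The class `[M]` of a compact object. -/
noncomputable def GrDgK0.mk (M : (compactGrDg 𝒜).FullSubcategory) : GrDgK0 𝒜 :=
  Submodule.Quotient.mk (.single M 1)

end Graded

/-!
The argument works in any abelian category with arbitrary coproducts and a set of compact
projective generators, for a class `𝒬` of compact projectives containing the generators and closed
under finite direct sums and retracts. Finitely generated (graded) projective modules are such a
class because a finitely generated module is compact: a morphism from it to a direct sum lands in a
finite subsum.

The compact objects of the derived category form the thick subcategory generated by the generators.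
Indeed, a compact `M` is followed along a sequence of morphisms, each of which is the cone of a
direct sum of shifted generators and kills all morphisms from shifted generators; the composition
out of `M` vanishes at a finite stage because the homotopy colimit is zero, and backtracking
exhibits `M` as a retract of a finite extension of shifted generators.

The class `𝒬` is presilting, that is, `Hom(P, P'[k]) = 0` for `k > 0`. Hence the horseshoe and
Schanuel lemmas hold for finite resolutions by objects of `𝒬`, which therefore make the Euler
characteristic `∑ (-1)ⁱ [Pⁱ]` well defined and additive on distinguished triangles. Having such a
resolution passes to retracts, so every compact object has one up to a shift, and the Euler
characteristic is the inverse of `[P] ↦ [P]`.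
-/

section Triangles

open ZeroObject Triangulated

variable {D : Type*} [Category* D] [Preadditive D] [HasZeroObject D] [HasShift D ℤ]
  [∀ n : ℤ, (shiftFunctor D n).Additive] [Pretriangulated D]

section

variable {X Y Z : D} {f : X ⟶ Y} {g : Y ⟶ Z} {h : Z ⟶ X⟦(1 : ℤ)⟧}

theorem distTriang_of_iso (hT : Triangle.mk f g h ∈ distTriang D) {X' Y' Z' : D} {f' : X' ⟶ Y'}
    {g' : Y' ⟶ Z'} {h' : Z' ⟶ X'⟦(1 : ℤ)⟧} (a : X' ≅ X) (b : Y' ≅ Y) (c : Z' ≅ Z)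
    (hf : f' ≫ b.hom = a.hom ≫ f) (hg : g' ≫ c.hom = b.hom ≫ g)
    (hh : h' ≫ a.hom⟦1⟧' = c.hom ≫ h) : Triangle.mk f' g' h' ∈ distTriang D :=
  isomorphic_distinguished _ hT _ (Triangle.isoMk _ _ a b c hf hg hh)

theorem distTriang_congr₁ (hT : Triangle.mk f g h ∈ distTriang D) {X' : D} (e : X ≅ X') :
    Triangle.mk (e.inv ≫ f) g (h ≫ e.hom⟦1⟧') ∈ distTriang D :=
  distTriang_of_iso hT e.symm (Iso.refl _) (Iso.refl _) (by simp) (by simp)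
    (by simp [← Functor.map_comp])

theorem distTriang_congr₂ (hT : Triangle.mk f g h ∈ distTriang D) {Y' : D} (e : Y ≅ Y') :
    Triangle.mk (f ≫ e.hom) (e.inv ≫ g) h ∈ distTriang D :=
  distTriang_of_iso hT (Iso.refl _) e.symm (Iso.refl _) (by simp) (by simp) (by simp)

theorem distTriang_congr₃ (hT : Triangle.mk f g h ∈ distTriang D) {Z' : D} (e : Z ≅ Z') :
    Triangle.mk f (g ≫ e.hom) (e.inv ≫ h) ∈ distTriang D :=
  distTriang_of_iso hT (Iso.refl _) (Iso.refl _) e.symm (by simp) (by simp) (by simp)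

theorem distTriang_rotate (hT : Triangle.mk f g h ∈ distTriang D) :
    Triangle.mk g h (-f⟦(1 : ℤ)⟧') ∈ distTriang D :=
  rot_of_distTriang _ hT

theorem nonempty_iso_biprod_of_distTriang (hT : Triangle.mk f g h ∈ distTriang D) (hh : h = 0) :
    Nonempty (Y ≅ X ⊞ Z) :=
  ⟨(exists_iso_binaryBiproduct_of_distTriang _ hT hh).choose⟩

theorem exists_distTriang_of_shift {u : X⟦(1 : ℤ)⟧ ⟶ Y⟦(1 : ℤ)⟧}
    {v : Y⟦(1 : ℤ)⟧ ⟶ Z⟦(1 : ℤ)⟧⟦(1 : ℤ)⟧} {w : Z⟦(1 : ℤ)⟧⟦(1 : ℤ)⟧ ⟶ X⟦(1 : ℤ)⟧⟦(1 : ℤ)⟧}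
    (hT : Triangle.mk u v w ∈ distTriang D) :
    ∃ (f : Z ⟶ X) (g : X ⟶ Y) (h : Y ⟶ Z⟦(1 : ℤ)⟧), Triangle.mk f g h ∈ distTriang D := by
  obtain ⟨u, rfl⟩ := (shiftFunctor D (1 : ℤ)).map_surjective u
  obtain ⟨Z', f, h, hZ'⟩ := distinguished_cocone_triangle₁ (-u)
  have hZ'' := distTriang_rotate (distTriang_rotate (distTriang_rotate (distTriang_rotate hZ')))
  let e := isoTriangleOfIso₁₂ _ _ hZ'' hT (Iso.refl _) (Iso.refl _) (by
      change (-(-u)⟦(1 : ℤ)⟧') ≫ 𝟙 _ = 𝟙 _ ≫ u⟦(1 : ℤ)⟧'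
      simp)
  let e₃ : Z'⟦(1 : ℤ)⟧⟦(1 : ℤ)⟧ ≅ Z⟦(1 : ℤ)⟧⟦(1 : ℤ)⟧ := Triangle.π₃.mapIso e
  exact ⟨_, _, _, distTriang_congr₁ hZ'
    ((shiftFunctor D (1 : ℤ)).preimageIso ((shiftFunctor D (1 : ℤ)).preimageIso e₃))⟩

end

variable [IsTriangulated D]

theorem exists_distTriang_biprod {N X M : D} {f : N ⟶ X} {g : X ⟶ M} {h : M ⟶ N⟦(1 : ℤ)⟧}
    (hT : Triangle.mk f g h ∈ distTriang D) (Q : D) :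
    ∃ (f' : N ⟶ X ⊞ Q) (g' : X ⊞ Q ⟶ M ⊞ Q) (h' : M ⊞ Q ⟶ N⟦(1 : ℤ)⟧),
      Triangle.mk f' g' h' ∈ distTriang D := by
  obtain ⟨Z, v, w, hZ⟩ := distinguished_cocone_triangle (f ≫ (biprod.inl : X ⟶ X ⊞ Q))
  let o := someOctahedron rfl hT (binaryBiproductTriangle_distinguished X Q) hZ
  obtain ⟨e⟩ := nonempty_iso_biprod_of_distTriang o.mem zero_comp
  exact ⟨_, _, _, distTriang_congr₃ hZ e⟩

theorem nonempty_iso_biprod_of_lift {N X M X' E : D} {f : N ⟶ X} {p : X ⟶ M}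
    {h : M ⟶ N⟦(1 : ℤ)⟧} (hT : Triangle.mk f p h ∈ distTriang D) (s : X' ⟶ X)
    {i : E ⟶ X ⊞ X'} {k : M ⟶ E⟦(1 : ℤ)⟧}
    (hE : Triangle.mk i (biprod.desc p (s ≫ p)) k ∈ distTriang D) : Nonempty (E ≅ N ⊞ X') := by
  -- This shear turns `X ⊞ X' ⟶ M` into the projection to `X` followed by `p`.
  let e : X' ⊞ X ≅ X ⊞ X' :=
    { hom := biprod.lift (biprod.snd - biprod.fst ≫ s) biprod.fst
      inv := biprod.lift biprod.snd (biprod.fst + biprod.snd ≫ s)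
      hom_inv_id := by ext <;> simp
      inv_hom_id := by ext <;> simp }
  have hX := distTriang_congr₂ (binaryBiproductTriangle_distinguished X' X) e
  let o := someOctahedron' (u₁₃ := biprod.desc p (s ≫ p)) (by ext <;> simp [e]) hX hT hE
  obtain ⟨e'⟩ := nonempty_iso_biprod_of_distTriang o.mem comp_zero
  exact ⟨e' ≪≫ biprod.braiding _ _⟩

theorem schanuel {N X M N' X' : D} {f : N ⟶ X} {g : X ⟶ M} {h : M ⟶ N⟦(1 : ℤ)⟧}
    {f' : N' ⟶ X'} {g' : X' ⟶ M} {h' : M ⟶ N'⟦(1 : ℤ)⟧}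
    (hT : Triangle.mk f g h ∈ distTriang D) (hT' : Triangle.mk f' g' h' ∈ distTriang D)
    {s : X' ⟶ X} (hs : g' = s ≫ g) {s' : X ⟶ X'} (hs' : g = s' ≫ g') :
    Nonempty (N ⊞ X' ≅ N' ⊞ X) := by
  obtain ⟨E, i, k, hE⟩ := distinguished_cocone_triangle₁ (biprod.desc g g')
  obtain ⟨e⟩ := nonempty_iso_biprod_of_lift hT s (by rw [← hs]; exact hE)
  have hE' := distTriang_congr₂ hE (biprod.braiding X X')
  have hdesc : (biprod.braiding X X').inv ≫ biprod.desc g g' = biprod.desc g' (s' ≫ g') := by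
    rw [← hs']
    ext <;> simp
  rw [hdesc] at hE'
  obtain ⟨e'⟩ := nonempty_iso_biprod_of_lift hT' s' hE'
  exact ⟨e.symm ≪≫ e'⟩

theorem horseshoe {N₁ X₁ M₁ N₃ X₃ M₃ M₂ : D}
    {a₁ : N₁ ⟶ X₁} {p₁ : X₁ ⟶ M₁} {b₁ : M₁ ⟶ N₁⟦(1 : ℤ)⟧}
    {a₃ : N₃ ⟶ X₃} {p₃ : X₃ ⟶ M₃} {b₃ : M₃ ⟶ N₃⟦(1 : ℤ)⟧}
    {f : M₁ ⟶ M₂} {g : M₂ ⟶ M₃} {h : M₃ ⟶ M₁⟦(1 : ℤ)⟧}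
    (hT₁ : Triangle.mk a₁ p₁ b₁ ∈ distTriang D) (hT₃ : Triangle.mk a₃ p₃ b₃ ∈ distTriang D)
    (hT : Triangle.mk f g h ∈ distTriang D) {s : X₃ ⟶ M₂} (hs : p₃ = s ≫ g) :
    ∃ (N₂ : D) (a₂ : N₂ ⟶ X₁ ⊞ X₃) (p₂ : X₁ ⊞ X₃ ⟶ M₂) (b₂ : M₂ ⟶ N₂⟦(1 : ℤ)⟧)
      (u : N₁ ⟶ N₂) (v : N₂ ⟶ N₃) (w : N₃ ⟶ N₁⟦(1 : ℤ)⟧),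
      Triangle.mk a₂ p₂ b₂ ∈ distTriang D ∧ Triangle.mk u v w ∈ distTriang D := by
  -- The cone `C` of `X₁ ⟶ M₂` receives `X₃` with cone `N₂⟦1⟧` and maps to `M₃` with fibre `N₁⟦1⟧`.
  obtain ⟨C, c, d, hC⟩ := distinguished_cocone_triangle (p₁ ≫ f)
  let o₁ := someOctahedron rfl (distTriang_rotate hT₁) hT hC
  obtain ⟨N₂, a₂, b₂, hN₂⟩ := distinguished_cocone_triangle₁ (biprod.desc (p₁ ≫ f) s)
  let o₂ := someOctahedron (u₁₃ := p₁ ≫ f) (by simp)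
    (binaryBiproductTriangle_distinguished X₁ X₃) (distTriang_rotate hN₂) hC
  have hp₃ : o₂.m₁ ≫ o₁.m₃ = p₃ := by
    have hfg : f ≫ g = 0 := comp_distTriang_mor_zero₁₂ _ hT
    have hm₁ := o₂.comm₁
    have hm₃ := o₁.comm₃
    rw [← cancel_epi (biprod.snd : X₁ ⊞ X₃ ⟶ X₃), reassoc_of% hm₁, hm₃]
    ext
    · simp [hfg]
    · simp [hs]
  let o₃ := someOctahedron hp₃ o₂.mem (distTriang_rotate o₁.mem) (distTriang_rotate hT₃)
  obtain ⟨u, v, w, hN⟩ := exists_distTriang_of_shift o₃.mem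
  exact ⟨N₂, a₂, _, b₂, u, v, w, hN₂, hN⟩

end Triangles

open ZeroObject in
/-- A presilting class `P` of objects of a triangulated category (closed under finite direct sums
and retracts, without positive self-extensions) together with an isomorphism invariant `cl` of its
objects, additive on direct sums. The function `cl` is total; its values outside `P` are never
used. -/
structure PresiltingInvariant (D : Type*) [Category* D] [Preadditive D] [HasZeroObject D]
    [HasShift D ℤ] [∀ n : ℤ, (shiftFunctor D n).Additive] [Pretriangulated D]
    (G : Type*) [AddCommGroup G] where
  P : ObjectProperty D
  cl : D → G
  zero : P (0 : D)
  biprod : ∀ {X Y : D}, P X → P Y → P (X ⊞ Y)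
  retract : ∀ {X Y : D}, Retract X Y → P Y → P X
  cl_iso : ∀ {X Y : D}, (X ≅ Y) → P X → cl X = cl Y
  cl_biprod : ∀ {X Y : D}, P X → P Y → cl (X ⊞ Y) = cl X + cl Y
  hom_eq_zero : ∀ {X Y : D}, P X → P Y → ∀ k : ℤ, 0 < k → ∀ f : X ⟶ Y⟦k⟧, f = 0

namespace PresiltingInvariant

open Triangulated ZeroObject

variable {D : Type*} [Category* D] [Preadditive D] [HasZeroObject D] [HasShift D ℤ]
  [∀ n : ℤ, (shiftFunctor D n).Additive] [Pretriangulated D]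
  {G : Type*} [AddCommGroup G] (S : PresiltingInvariant D G)

theorem cl_zero : S.cl 0 = 0 := by
  have e : (0 : D) ≅ 0 ⊞ 0 :=
    (isZero_zero D).iso ((IsZero.iff_id_eq_zero _).2 (by ext))
  have h := S.cl_biprod S.zero S.zero
  rw [← S.cl_iso e S.zero] at h
  simpa using h

/-- `S.HasResolution n M x`: iterating `n` times the formation of cones `N ⟶ X ⟶ M` with `X` in
`S.P` builds `M` from objects of `S.P`, and the alternating sum of their classes is `x`. -/
inductive HasResolution : ℕ → D → G → Prop
  | zero {M : D} (hM : S.P M) : HasResolution 0 M (S.cl M)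
  | succ {n : ℕ} {N X M : D} {f : N ⟶ X} {g : X ⟶ M} {h : M ⟶ N⟦(1 : ℤ)⟧} {y : G}
      (hX : S.P X) (hT : Triangle.mk f g h ∈ distTriang D) (hN : HasResolution n N y) :
      HasResolution (n + 1) M (S.cl X - y)

variable {S}

namespace HasResolution

theorem exists_of_zero {M : D} {x : G} (h : S.HasResolution 0 M x) : S.P M ∧ x = S.cl M := by
  cases h with
  | zero hM => exact ⟨hM, rfl⟩

theorem exists_of_succ {n : ℕ} {M : D} {x : G} (h : S.HasResolution (n + 1) M x) :
    ∃ (N X : D) (f : N ⟶ X) (g : X ⟶ M) (h : M ⟶ N⟦(1 : ℤ)⟧) (y : G), S.P X ∧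
      Triangle.mk f g h ∈ distTriang D ∧ S.HasResolution n N y ∧ x = S.cl X - y := by
  cases h with
  | succ hX hT hN => exact ⟨_, _, _, _, _, _, hX, hT, hN, rfl⟩

theorem hom_eq_zero {n : ℕ} {M : D} {x : G} (h : S.HasResolution n M x) {X : D} (hX : S.P X)
    {k : ℤ} (hk : 0 < k) (f : X ⟶ M⟦k⟧) : f = 0 := by
  induction h generalizing k with
  | zero hM => exact S.hom_eq_zero hX hM k hk f
  | @succ _ N Y M _ _ _ _ hY hT _ ih =>
    have hN (u : X ⟶ N⟦k⟧⟦(1 : ℤ)⟧) : u = 0 := by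
      rw [← cancel_mono ((shiftFunctorAdd' D k 1 (k + 1) rfl).inv.app N), zero_comp]
      exact ih (by lia) _
    obtain ⟨l, hl⟩ : ∃ l : X ⟶ Y⟦k⟧, f = l ≫ _ :=
      Triangle.coyoneda_exact₃ _ (Triangle.shift_distinguished _ hT k) f (hN _)
    rw [S.hom_eq_zero hX hY k hk l] at hl
    exact hl.trans zero_comp

theorem exists_lift {n : ℕ} {N X M X' : D} {f : N ⟶ X} {g : X ⟶ M} {h : M ⟶ N⟦(1 : ℤ)⟧} {y : G}
    (hN : S.HasResolution n N y) (hT : Triangle.mk f g h ∈ distTriang D) (hX' : S.P X')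
    (u : X' ⟶ M) : ∃ s : X' ⟶ X, u = s ≫ g :=
  Triangle.coyoneda_exact₃ _ hT u (hN.hom_eq_zero hX' one_pos _)

theorem of_iso {n : ℕ} {M M' : D} {x : G} (h : S.HasResolution n M x) (e : M ≅ M') :
    S.HasResolution n M' x := by
  cases h with
  | zero hM =>
    rw [S.cl_iso e hM]
    exact .zero (S.retract e.symm.retract hM)
  | succ hX hT hN => exact .succ hX (distTriang_congr₃ hT e) hN

theorem succ_length {n : ℕ} {M : D} {x : G} (h : S.HasResolution n M x) :
    S.HasResolution (n + 1) M x := by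
  induction h with
  | @zero M hM =>
    rw [← sub_zero (S.cl M), ← S.cl_zero]
    exact .succ hM (contractible_distinguished₁ M) (.zero S.zero)
  | succ hX hT _ ih => exact .succ hX hT ih

theorem mono {n m : ℕ} {M : D} {x : G} (h : S.HasResolution n M x) (hnm : n ≤ m) :
    S.HasResolution m M x := by
  induction hnm with
  | refl => exact h
  | step _ ih => exact ih.succ_length

theorem shift_one {n : ℕ} {M : D} {x : G} (h : S.HasResolution n M x) :
    S.HasResolution (n + 1) (M⟦(1 : ℤ)⟧) (-x) := by
  rw [← zero_sub, ← S.cl_zero]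
  exact .succ S.zero (contractible_distinguished₂ M) h

theorem shift_natCast {n : ℕ} {M : D} {x : G} (h : S.HasResolution n M x) (k : ℕ) :
    S.HasResolution (n + k) (M⟦(k : ℤ)⟧) ((-1 : ℤ) ^ k • x) := by
  induction k with
  | zero => simpa using h.of_iso ((shiftFunctorZero' D (0 : ℤ) rfl).symm.app M)
  | succ k ih =>
    rw [pow_succ, mul_neg_one, neg_smul]
    exact ih.shift_one.of_iso
      ((shiftFunctorAdd' D (k : ℤ) 1 ((k + 1 : ℕ) : ℤ) (by simp)).symm.app M)

theorem map {n : ℕ} {M : D} {x : G} (h : S.HasResolution n M x) (F : D ⥤ D) [F.CommShift ℤ]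
    [F.IsTriangulated] (ψ : G →+ G) (hP : ∀ X, S.P X → S.P (F.obj X))
    (hψ : ∀ X, S.P X → S.cl (F.obj X) = ψ (S.cl X)) : S.HasResolution n (F.obj M) (ψ x) := by
  induction h with
  | zero hM =>
    rw [← hψ _ hM]
    exact .zero (hP _ hM)
  | succ hX hT _ ih =>
    rw [map_sub, ← hψ _ hX]
    exact .succ (hP _ hX) (F.map_distinguished _ hT) ih

variable [IsTriangulated D]

theorem biprod {n : ℕ} {M Q : D} {x : G} (h : S.HasResolution n M x) (hQ : S.P Q) :
    S.HasResolution n (M ⊞ Q) (x + S.cl Q) := by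
  cases h with
  | zero hM =>
    rw [← S.cl_biprod hM hQ]
    exact .zero (S.biprod hM hQ)
  | succ hX hT hN =>
    obtain ⟨_, _, _, hT'⟩ := exists_distTriang_biprod hT Q
    rw [sub_add_eq_add_sub, ← S.cl_biprod hX hQ]
    exact .succ (S.biprod hX hQ) hT' hN

theorem unique {n : ℕ} {M : D} {x x' : G} (h : S.HasResolution n M x)
    (h' : S.HasResolution n M x') : x = x' := by
  induction n generalizing M x x' with
  | zero => rw [h.exists_of_zero.2, h'.exists_of_zero.2]
  | succ n ih =>
    obtain ⟨N, X, _, _, _, y, hX, hT, hN, rfl⟩ := h.exists_of_succ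
    obtain ⟨N', X', _, _, _, y', hX', hT', hN', rfl⟩ := h'.exists_of_succ
    obtain ⟨s, hs⟩ := hN.exists_lift hT hX' _
    obtain ⟨s', hs'⟩ := hN'.exists_lift hT' hX _
    obtain ⟨e⟩ := schanuel hT hT' hs hs'
    have hy : y + S.cl X' = y' + S.cl X := ih ((hN.biprod hX').of_iso e) (hN'.biprod hX)
    rw [sub_eq_sub_iff_add_eq_add, add_comm, ← hy, add_comm]

theorem of_distTriang {n : ℕ} {M₁ M₂ M₃ : D} {x₁ x₃ : G} (h₁ : S.HasResolution n M₁ x₁)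
    (h₃ : S.HasResolution n M₃ x₃) {f : M₁ ⟶ M₂} {g : M₂ ⟶ M₃} {h : M₃ ⟶ M₁⟦(1 : ℤ)⟧}
    (hT : Triangle.mk f g h ∈ distTriang D) : S.HasResolution n M₂ (x₁ + x₃) := by
  induction n generalizing M₁ M₂ M₃ x₁ x₃ with
  | zero =>
    obtain ⟨hM₁, rfl⟩ := h₁.exists_of_zero
    obtain ⟨hM₃, rfl⟩ := h₃.exists_of_zero
    obtain ⟨e⟩ := nonempty_iso_biprod_of_distTriang hT (S.hom_eq_zero hM₃ hM₁ 1 one_pos _)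
    rw [← S.cl_biprod hM₁ hM₃]
    exact HasResolution.of_iso (.zero (S.biprod hM₁ hM₃)) e.symm
  | succ n ih =>
    obtain ⟨N₁, X₁, _, _, _, y₁, hX₁, hT₁, hN₁, rfl⟩ := id h₁.exists_of_succ
    obtain ⟨N₃, X₃, _, p₃, _, y₃, hX₃, hT₃, hN₃, rfl⟩ := h₃.exists_of_succ
    obtain ⟨s, hs⟩ := h₁.exists_lift hT hX₃ p₃
    obtain ⟨N₂, _, _, _, _, _, _, hT₂, hN⟩ := horseshoe hT₁ hT₃ hT hs
    rw [sub_add_sub_comm, ← S.cl_biprod hX₁ hX₃]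
    exact .succ (S.biprod hX₁ hX₃) hT₂ (ih hN₁ hN₃ hN)

theorem exists_of_biprod {n : ℕ} {M M' : D} {x : G} (h : S.HasResolution n (M ⊞ M') x) :
    ∃ y, S.HasResolution n M y := by
  induction n generalizing M M' x with
  | zero =>
    exact ⟨_, .zero (S.retract ⟨biprod.inl, biprod.fst, by simp⟩ h.exists_of_zero.1)⟩
  | succ n ih =>
    obtain ⟨N, X, a, p, b, y, hX, hT, hN, rfl⟩ := h.exists_of_succ
    -- The fibres `N₁`, `N₂` of `X ⟶ M` and `X ⟶ M'` satisfy `N ⊞ X ≅ N₂ ⊞ N₁` by Schanuel's lemma.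
    obtain ⟨N₁, a₁, b₁, h₁⟩ := distinguished_cocone_triangle₁ (p ≫ biprod.fst)
    obtain ⟨N₂, a₂, b₂, h₂⟩ := distinguished_cocone_triangle₁ (p ≫ biprod.snd)
    have hM := distTriang_congr₂ (binaryBiproductTriangle_distinguished M' M)
      (biprod.braiding M' M)
    have hfst : (biprod.braiding M' M).inv ≫ biprod.snd = biprod.fst := by simp
    rw [hfst] at hM
    let o := someOctahedron' rfl hT hM h₁
    have ho : o.m₃ = a₁ ≫ p ≫ biprod.snd := by
      have hm₃ := o.comm₄
      rw [← Category.assoc, ← hm₃]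
      simp
    obtain ⟨s, hs⟩ := hN.exists_lift o.mem hX (p ≫ biprod.snd)
    obtain ⟨e⟩ := schanuel o.mem h₂ hs ho
    obtain ⟨y₁, hy₁⟩ := ih (((hN.biprod hX).of_iso e).of_iso (biprod.braiding _ _))
    exact ⟨_, .succ hX h₁ hy₁⟩

theorem exists_of_retract {n : ℕ} {M M' : D} {x : G} (h : S.HasResolution n M' x)
    (r : Retract M M') : ∃ y, S.HasResolution n M y := by
  obtain ⟨Z, _, δ, hT⟩ := distinguished_cocone_triangle r.i
  have hδ : δ = 0 := by
    have hδi : δ ≫ r.i⟦(1 : ℤ)⟧' = 0 := comp_distTriang_mor_zero₃₁ _ hT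
    rw [← Category.comp_id δ, ← (shiftFunctor D (1 : ℤ)).map_id, ← r.retract, Functor.map_comp,
      reassoc_of% hδi, zero_comp]
  obtain ⟨e⟩ := nonempty_iso_biprod_of_distTriang hT hδ
  exact (h.of_iso e).exists_of_biprod

end HasResolution

variable (S) in
/-- `S.HasEulerChar M x`: some shift of `M` has a finite resolution by objects of `S.P`, and the
alternating sum of classes in it, corrected by the sign of the shift, is `x`. -/
def HasEulerChar (M : D) (x : G) : Prop :=
  ∃ k n : ℕ, S.HasResolution n (M⟦(k : ℤ)⟧) ((-1 : ℤ) ^ k • x)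

namespace HasEulerChar

theorem of_prop {M : D} (hM : S.P M) : S.HasEulerChar M (S.cl M) :=
  ⟨0, 0, by
    simpa using (HasResolution.zero hM).of_iso ((shiftFunctorZero' D (0 : ℤ) rfl).symm.app M)⟩

theorem of_iso {M M' : D} {x : G} (h : S.HasEulerChar M x) (e : M ≅ M') :
    S.HasEulerChar M' x := by
  obtain ⟨k, n, h⟩ := h
  exact ⟨k, n, h.of_iso ((shiftFunctor D (k : ℤ)).mapIso e)⟩

theorem exists_forall_hasResolution {M : D} {x : G} (h : S.HasEulerChar M x) :
    ∃ a : ℕ, ∀ k, a ≤ k →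
      ∃ b : ℕ, ∀ n, b ≤ n → S.HasResolution n (M⟦(k : ℤ)⟧) ((-1 : ℤ) ^ k • x) := by
  obtain ⟨a, n, h⟩ := h
  refine ⟨a, fun k hk => ?_⟩
  obtain ⟨l, rfl⟩ := Nat.exists_eq_add_of_le hk
  have hl := (h.shift_natCast l).of_iso
    ((shiftFunctorAdd' D (a : ℤ) l ((a + l : ℕ) : ℤ) (by simp)).symm.app M)
  rw [smul_smul, ← pow_add, add_comm l] at hl
  exact ⟨_, fun m hm => hl.mono hm⟩

theorem exists_common {M M' : D} {x x' : G} (h : S.HasEulerChar M x)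
    (h' : S.HasEulerChar M' x') :
    ∃ k n : ℕ, S.HasResolution n (M⟦(k : ℤ)⟧) ((-1 : ℤ) ^ k • x) ∧
      S.HasResolution n (M'⟦(k : ℤ)⟧) ((-1 : ℤ) ^ k • x') := by
  obtain ⟨a, ha⟩ := h.exists_forall_hasResolution
  obtain ⟨a', ha'⟩ := h'.exists_forall_hasResolution
  obtain ⟨b, hb⟩ := ha (a + a') (by lia)
  obtain ⟨b', hb'⟩ := ha' (a + a') (by lia)
  exact ⟨a + a', b + b', hb _ (by lia), hb' _ (by lia)⟩

theorem shift_one {M : D} {x : G} (h : S.HasEulerChar M x) :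
    S.HasEulerChar (M⟦(1 : ℤ)⟧) (-x) := by
  obtain ⟨k, n, h⟩ := h
  refine ⟨k, n + 1, ?_⟩
  rw [smul_neg]
  exact h.shift_one.of_iso ((shiftFunctorComm D (k : ℤ) 1).app M)

theorem shift_neg_one {M : D} {x : G} (h : S.HasEulerChar M x) :
    S.HasEulerChar (M⟦(-1 : ℤ)⟧) (-x) := by
  obtain ⟨k, n, h⟩ := h
  refine ⟨k + 1, n, ?_⟩
  rw [pow_succ, mul_neg_one, neg_smul, smul_neg, neg_neg]
  exact h.of_iso ((shiftFunctorAdd' D (-1) ((k + 1 : ℕ) : ℤ) (k : ℤ) (by simp)).app M)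

theorem map {M : D} {x : G} (h : S.HasEulerChar M x) (F : D ⥤ D) [F.CommShift ℤ]
    [F.IsTriangulated] (ψ : G →+ G) (hP : ∀ X, S.P X → S.P (F.obj X))
    (hψ : ∀ X, S.P X → S.cl (F.obj X) = ψ (S.cl X)) : S.HasEulerChar (F.obj M) (ψ x) := by
  obtain ⟨k, n, h⟩ := h
  refine ⟨k, n, ?_⟩
  rw [← map_zsmul]
  exact (h.map F ψ hP hψ).of_iso ((F.commShiftIso (k : ℤ)).app M)

variable [IsTriangulated D]

theorem unique {M : D} {x x' : G} (h : S.HasEulerChar M x) (h' : S.HasEulerChar M x') :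
    x = x' := by
  obtain ⟨k, n, hx, hx'⟩ := h.exists_common h'
  have heq := hx.unique hx'
  rcases neg_one_pow_eq_or ℤ k with hk | hk <;> simpa [hk] using heq

theorem of_distTriang {M₁ M₂ M₃ : D} {x₁ x₃ : G} (h₁ : S.HasEulerChar M₁ x₁)
    (h₃ : S.HasEulerChar M₃ x₃) {f : M₁ ⟶ M₂} {g : M₂ ⟶ M₃} {h : M₃ ⟶ M₁⟦(1 : ℤ)⟧}
    (hT : Triangle.mk f g h ∈ distTriang D) : S.HasEulerChar M₂ (x₁ + x₃) := by
  obtain ⟨k, n, h₁, h₃⟩ := h₁.exists_common h₃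
  refine ⟨k, n, ?_⟩
  rw [smul_add]
  exact h₁.of_distTriang h₃ (Triangle.shift_distinguished _ hT _)

end HasEulerChar

variable (S) in
/-- The objects some shift of which has a finite resolution by objects of `S.P`. -/
def resolvable : ObjectProperty D := fun M => ∃ x, S.HasEulerChar M x

variable (S) in
theorem le_resolvable : S.P ≤ S.resolvable := fun _ hM => ⟨_, .of_prop hM⟩

instance : S.resolvable.IsClosedUnderIsomorphisms where
  of_iso e := fun ⟨x, hx⟩ => ⟨x, hx.of_iso e⟩

instance : S.resolvable.IsStableUnderShift ℤ where
  isStableUnderShiftBy k := ⟨fun M ⟨x, hx⟩ => by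
    induction k with
    | zero => exact ⟨_, hx.of_iso ((shiftFunctorZero D ℤ).symm.app M)⟩
    | succ k ih =>
      obtain ⟨_, hy⟩ := ih
      exact ⟨_, hy.shift_one.of_iso ((shiftFunctorAdd' D (k : ℤ) 1 _ rfl).symm.app M)⟩
    | pred k ih =>
      obtain ⟨_, hy⟩ := ih
      exact ⟨_, hy.shift_neg_one.of_iso ((shiftFunctorAdd' D (-k : ℤ) (-1) _ rfl).symm.app M)⟩⟩

variable [IsTriangulated D]

instance : S.resolvable.IsStableUnderRetracts where
  of_retract {M M'} r := fun ⟨x, k, n, h⟩ => by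
    obtain ⟨y, hy⟩ := h.exists_of_retract (r.map (shiftFunctor D (k : ℤ)))
    refine ⟨(-1 : ℤ) ^ k • y, k, n, ?_⟩
    rwa [smul_smul, ← mul_pow, neg_one_mul, neg_neg, one_pow, one_smul]

instance : S.resolvable.IsTriangulated where
  exists_zero := ⟨0, isZero_zero D, S.le_resolvable _ S.zero⟩
  toIsTriangulatedClosed₂ := .mk' fun _ hT ⟨_, h₁⟩ ⟨_, h₃⟩ => ⟨_, h₁.of_distTriang h₃ hT⟩

end PresiltingInvariant

section Coproducts

variable {D : Type*} [Category* D] [Preadditive D] {J : Type*} {N : J → D} {c : Cofan N}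
  (hc : IsColimit c)

open Classical in
/-- The projection of a coproduct in a preadditive category onto one of its summands. -/
noncomputable def coprodProj (j : J) : c.pt ⟶ N j :=
  Cofan.IsColimit.desc hc fun k => if e : k = j then eqToHom (congrArg N e) else 0

theorem inj_coprodProj_self (j : J) : c.inj j ≫ coprodProj hc j = 𝟙 (N j) := by
  simp [coprodProj]

theorem inj_coprodProj_of_ne {j k : J} (hjk : j ≠ k) : c.inj j ≫ coprodProj hc k = 0 := by
  simp [coprodProj, hjk]

/-- The idempotent endomorphism of a coproduct which projects onto the finite subsum of the
summands in `T`. -/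
noncomputable def coprodIdem (T : Finset J) : c.pt ⟶ c.pt :=
  ∑ j ∈ T, coprodProj hc j ≫ c.inj j

theorem inj_coprodIdem {T : Finset J} {j : J} (hj : j ∈ T) :
    c.inj j ≫ coprodIdem hc T = c.inj j := by
  rw [coprodIdem, Preadditive.comp_sum, Finset.sum_eq_single_of_mem j hj fun k _ hkj => ?_,
    reassoc_of% inj_coprodProj_self hc j]
  rw [reassoc_of% inj_coprodProj_of_ne hc hkj.symm, zero_comp]

theorem coprodIdem_comp_coprodProj {T : Finset J} {j : J} (hj : j ∉ T) :
    coprodIdem hc T ≫ coprodProj hc j = 0 := by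
  rw [coprodIdem, Preadditive.sum_comp]
  refine Finset.sum_eq_zero fun k hk => ?_
  rw [Category.assoc, inj_coprodProj_of_ne hc (ne_of_mem_of_not_mem hk hj), comp_zero]

theorem coprodIdem_comp_coprodIdem {T T' : Finset J} (hT : T ⊆ T') :
    coprodIdem hc T ≫ coprodIdem hc T' = coprodIdem hc T := by
  simp only [coprodIdem, Preadditive.sum_comp, Category.assoc]
  exact Finset.sum_congr rfl fun j hj => congrArg _ (inj_coprodIdem hc (hT hj))

variable {M : D}

theorem comp_coprodIdem_of_eq_sum {f : M ⟶ c.pt} {T : Finset J} {g : ∀ j, M ⟶ N j}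
    (hf : f = ∑ j ∈ T, g j ≫ c.inj j) : f ≫ coprodIdem hc T = f := by
  rw [hf, Preadditive.sum_comp]
  refine Finset.sum_congr rfl fun j hj => ?_
  rw [Category.assoc, inj_coprodIdem hc hj]

theorem exists_retract_of_coprodIdem [HasFiniteBiproducts D] (T : Finset J) :
    ∃ (b : (⨁ fun j : T => N j) ⟶ c.pt) (r : c.pt ⟶ ⨁ fun j : T => N j),
      b ≫ r = 𝟙 _ ∧ r ≫ b = coprodIdem hc T := by
  classical
  refine ⟨biproduct.desc fun j => c.inj j, biproduct.lift fun j => coprodProj hc j, ?_, ?_⟩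
  · refine biproduct.hom_ext' _ _ fun j => biproduct.hom_ext _ _ fun k => ?_
    simp only [Category.assoc, biproduct.ι_desc_assoc, biproduct.lift_π, Category.comp_id]
    obtain rfl | hjk := eq_or_ne j k
    · rw [inj_coprodProj_self, biproduct.ι_π_self]
    · rw [inj_coprodProj_of_ne hc (Subtype.coe_injective.ne hjk), biproduct.ι_π_ne _ hjk]
  · rw [← Category.id_comp (biproduct.desc _), ← IsBilimit.total (biproduct.isBilimit _),
      Preadditive.sum_comp, Preadditive.comp_sum, coprodIdem,
      ← Finset.sum_coe_sort T fun j => coprodProj hc j ≫ c.inj j]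
    refine Finset.sum_congr rfl fun j _ => ?_
    rw [Category.assoc]
    exact (biproduct.lift_π_assoc _ _ _).trans (congrArg _ (biproduct.ι_desc _ _))

theorem map_coprodProj {D' : Type*} [Category* D'] [Preadditive D'] (F : D ⥤ D') [F.Additive]
    (hc' : IsColimit (Cofan.mk (F.obj c.pt) fun j => F.map (c.inj j))) (j : J) :
    F.map (coprodProj hc j) = coprodProj hc' j := by
  refine Cofan.IsColimit.hom_ext hc' _ _ fun k => ?_
  have h : F.map (c.inj k) ≫ F.map (coprodProj hc j) = F.map (c.inj k ≫ coprodProj hc j) :=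
    (F.map_comp _ _).symm
  refine h.trans ?_
  obtain rfl | hkj := eq_or_ne k j
  · rw [inj_coprodProj_self hc, F.map_id, inj_coprodProj_self hc']
  · rw [inj_coprodProj_of_ne hc hkj, F.map_zero, inj_coprodProj_of_ne hc' hkj]

theorem map_coprodIdem {D' : Type*} [Category* D'] [Preadditive D'] (F : D ⥤ D') [F.Additive]
    (hc' : IsColimit (Cofan.mk (F.obj c.pt) fun j => F.map (c.inj j))) (T : Finset J) :
    F.map (coprodIdem hc T) = coprodIdem hc' T := by
  simp only [coprodIdem, F.map_sum, F.map_comp, map_coprodProj hc F hc', Cofan.mk_pt, cofan_mk_inj]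

open Classical in
theorem toAddMonoid_comp_coprodProj (x : DirectSum J fun j => (M ⟶ N j)) (j : J) :
    DirectSum.toAddMonoid (fun k => Preadditive.rightComp M (c.inj k)) x ≫ coprodProj hc j =
      x j := by
  induction x using DirectSum.induction_on with
  | zero => simp
  | of k f =>
    have h : Preadditive.rightComp M (c.inj k) f ≫ coprodProj hc j =
        f ≫ c.inj k ≫ coprodProj hc j := Category.assoc _ _ _
    rw [DirectSum.toAddMonoid_of, h]
    obtain rfl | hkj := eq_or_ne k j
    · rw [inj_coprodProj_self, Category.comp_id, DirectSum.of_eq_same]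
    · rw [inj_coprodProj_of_ne hc hkj, comp_zero, DirectSum.of_eq_of_ne _ _ _ hkj.symm]
  | add x y hx hy => rw [map_add, Preadditive.add_comp, hx, hy, DirectSum.add_apply]

end Coproducts

section CompactObjects

open ZeroObject

variable {D : Type*} [Category* D] [Preadditive D] {M : D}

/-- Surjectivity is the whole content of compactness: the comparison map is always injective,
because the components of a direct sum are recovered by the projections of the coproduct. -/
theorem isCompactObject_iff : isCompactObject.{t} D M ↔
    ∀ (J : Type t) (N : J → D) (c : Cofan N) (hc : IsColimit c) (f : M ⟶ c.pt),
      ∃ T : Finset J, f ≫ coprodIdem hc T = f := by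
  classical
  refine ⟨fun hM J N c hc f => ?_, fun hM J N c ⟨hc⟩ => ⟨?_, fun f => ?_⟩⟩
  · obtain ⟨x, rfl⟩ := (hM J N c ⟨hc⟩).2 f
    exact ⟨DFinsupp.support x, comp_coprodIdem_of_eq_sum hc (DFinsupp.sumAddHom_apply _ _)⟩
  · rw [injective_iff_map_eq_zero]
    intro x hx
    ext j
    rw [← toAddMonoid_comp_coprodProj hc x j, hx, zero_comp, DirectSum.zero_apply]
  · obtain ⟨T, hT⟩ := hM J N c hc f
    refine ⟨∑ j ∈ T, DirectSum.of (fun j => (M ⟶ N j)) j (f ≫ coprodProj hc j), ?_⟩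
    conv_rhs => rw [← hT, coprodIdem, Preadditive.comp_sum]
    rw [map_sum]
    refine Finset.sum_congr rfl fun j _ => ?_
    rw [DirectSum.toAddMonoid_of, ← Category.assoc]
    rfl

theorem exists_comp_coprodIdem (hM : isCompactObject.{t} D M) {J : Type t} {N : J → D}
    {c : Cofan N} (hc : IsColimit c) (f : M ⟶ c.pt) : ∃ T : Finset J, f ≫ coprodIdem hc T = f :=
  isCompactObject_iff.1 hM J N c hc f

theorem exists_comp_coprodIdem_nat (hM : isCompactObject.{t} D M) {N : ℕ → D} {c : Cofan N}
    (hc : IsColimit c) (f : M ⟶ c.pt) : ∃ T : Finset ℕ, f ≫ coprodIdem hc T = f := by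
  let c' : Cofan fun n : ULift.{t} ℕ => N n.down := Cofan.mk c.pt fun n => c.inj n.down
  let hc' : IsColimit c' := Cofan.IsColimit.mk c'
    (fun s => Cofan.IsColimit.desc hc fun n => s.inj ⟨n⟩)
    (fun s n => Cofan.IsColimit.fac hc (fun n => s.inj ⟨n⟩) n.down)
    fun s m hm => Cofan.IsColimit.hom_ext hc _ _ fun n =>
      (hm ⟨n⟩).trans (Cofan.IsColimit.fac hc (fun n => s.inj ⟨n⟩) n).symm
  obtain ⟨T, hT⟩ := exists_comp_coprodIdem hM hc' f
  refine ⟨T.map Equiv.ulift.toEmbedding, comp_coprodIdem_of_eq_sum hc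
    (g := fun n => f ≫ coprodProj hc' ⟨n⟩) ?_⟩
  rw [Finset.sum_map]
  refine hT.symm.trans ?_
  simp only [coprodIdem, Preadditive.comp_sum, Category.assoc]
  rfl

instance : (isCompactObject.{t} D).IsStableUnderRetracts where
  of_retract r hM := isCompactObject_iff.2 fun J N c hc f => by
    obtain ⟨T, hT⟩ := exists_comp_coprodIdem hM hc (r.r ≫ f)
    refine ⟨T, ?_⟩
    rw [← Category.id_comp f, ← r.retract, Category.assoc r.i, Category.assoc, hT]

theorem isCompactObject_of_isZero (hM : IsZero M) : isCompactObject.{t} D M :=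
  isCompactObject_iff.2 fun _ _ _ _ _ => ⟨∅, hM.eq_of_src _ _⟩

/-- The shift of a coproduct is a coproduct of the shifts. -/
noncomputable def isColimitShiftCofan [HasShift D ℤ] {J : Type*} {N : J → D} {c : Cofan N}
    (hc : IsColimit c) (n : ℤ) : IsColimit (Cofan.mk (c.pt⟦n⟧) fun j => (c.inj j)⟦n⟧') :=
  isColimitCofanMkObjOfIsColimit (shiftFunctor D n) _ _
    (hc.ofIsoColimit (Cofan.ext (Iso.refl _)) : IsColimit (Cofan.mk c.pt c.inj))

instance [HasShift D ℤ] [∀ n : ℤ, (shiftFunctor D n).Additive] :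
    (isCompactObject.{t} D).IsStableUnderShift ℤ where
  isStableUnderShiftBy n := ⟨fun M hM => isCompactObject_iff.2 fun J N c hc f => by
    have hM' : isCompactObject.{t} D (M⟦n⟧⟦-n⟧) :=
      (isCompactObject.{t} D).prop_of_iso (shiftShiftNeg M n).symm hM
    obtain ⟨T, hT⟩ := exists_comp_coprodIdem hM' (isColimitShiftCofan hc (-n)) (f⟦-n⟧')
    choose g hg using fun j => (shiftFunctor D (-n)).map_surjective
      (f⟦-n⟧' ≫ coprodProj (isColimitShiftCofan hc (-n)) j)
    refine ⟨T, comp_coprodIdem_of_eq_sum hc (g := g) ((shiftFunctor D (-n)).map_injective ?_)⟩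
    rw [← hT, coprodIdem, Preadditive.comp_sum, Functor.map_sum]
    refine Finset.sum_congr rfl fun j _ => ?_
    rw [Functor.map_comp, hg, Category.assoc]
    rfl⟩

variable [HasZeroObject D] [HasShift D ℤ] [∀ n : ℤ, (shiftFunctor D n).Additive]
  [Pretriangulated D]

instance : (isCompactObject.{t} D).IsTriangulatedClosed₂ := .mk' fun T hT hX hZ =>
  isCompactObject_iff.2 fun J N c hc k => by
    classical
    obtain ⟨S, hS⟩ := exists_comp_coprodIdem hX hc (T.mor₁ ≫ k)
    obtain ⟨l, hl⟩ : ∃ l : T.obj₃ ⟶ c.pt, k - k ≫ coprodIdem hc S = T.mor₂ ≫ l :=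
      Triangle.yoneda_exact₂ T hT _ (by rw [Preadditive.comp_sub, ← Category.assoc, hS, sub_self])
    obtain ⟨S', hS'⟩ := exists_comp_coprodIdem hZ hc l
    refine ⟨S ∪ S', ?_⟩
    have hl' : l ≫ coprodIdem hc (S ∪ S') = l := by
      rw [← hS', Category.assoc, coprodIdem_comp_coprodIdem hc Finset.subset_union_right]
    have h : (k - k ≫ coprodIdem hc S) ≫ coprodIdem hc (S ∪ S') = k - k ≫ coprodIdem hc S := by
      rw [hl, Category.assoc, hl']
    rwa [Preadditive.sub_comp, Category.assoc,
      coprodIdem_comp_coprodIdem hc Finset.subset_union_left, sub_left_inj] at h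

instance : (isCompactObject.{t} D).IsTriangulated where
  exists_zero := ⟨0, isZero_zero D, isCompactObject_of_isZero (isZero_zero D)⟩

end CompactObjects

section Telescope

variable {D : Type*} [Category* D] {X : ℕ → D} {c : Cofan X} (hc : IsColimit c)
  (σ : ∀ n, X n ⟶ X (n + 1))

/-- The endomorphism of the coproduct of a sequence which is induced by the transition maps; the
cone of `𝟙 - telescopeShift hc σ` is the homotopy colimit of the sequence. -/
noncomputable def telescopeShift : c.pt ⟶ c.pt :=
  Cofan.IsColimit.desc hc fun n => σ n ≫ c.inj (n + 1)

theorem inj_telescopeShift (n : ℕ) : c.inj n ≫ telescopeShift hc σ = σ n ≫ c.inj (n + 1) :=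
  Cofan.IsColimit.fac hc _ n

variable [Preadditive D]

theorem telescopeShift_coprodProj_zero : telescopeShift hc σ ≫ coprodProj hc 0 = 0 := by
  refine Cofan.IsColimit.hom_ext hc _ _ fun n => ?_
  rw [← Category.assoc, inj_telescopeShift, Category.assoc,
    inj_coprodProj_of_ne hc n.succ_ne_zero, comp_zero, comp_zero]

theorem telescopeShift_coprodProj_succ (n : ℕ) :
    telescopeShift hc σ ≫ coprodProj hc (n + 1) = coprodProj hc n ≫ σ n := by
  refine Cofan.IsColimit.hom_ext hc _ _ fun k => ?_
  rw [← Category.assoc, inj_telescopeShift, Category.assoc]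
  obtain rfl | hkn := eq_or_ne k n
  · rw [inj_coprodProj_self, reassoc_of% inj_coprodProj_self hc k, Category.comp_id]
  · rw [inj_coprodProj_of_ne hc (Nat.succ_injective.ne hkn), comp_zero,
      reassoc_of% inj_coprodProj_of_ne hc hkn, zero_comp]

theorem comp_coprodProj_eq_of_sub_telescopeShift {M : D} {τ : ∀ n, M ⟶ X n}
    (hτ : ∀ n, τ (n + 1) = τ n ≫ σ n) {m : M ⟶ c.pt}
    (hm : m ≫ (𝟙 c.pt - telescopeShift hc σ) = τ 0 ≫ c.inj 0) (n : ℕ) :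
    m ≫ coprodProj hc n = τ n := by
  have hm' : m = m ≫ telescopeShift hc σ + τ 0 ≫ c.inj 0 := by
    rw [← hm, Preadditive.comp_sub, Category.comp_id, add_sub_cancel]
  induction n with
  | zero =>
    rw [hm', Preadditive.add_comp, Category.assoc, telescopeShift_coprodProj_zero, comp_zero,
      zero_add, Category.assoc, inj_coprodProj_self, Category.comp_id]
  | succ n ih =>
    rw [hm', Preadditive.add_comp, Category.assoc, telescopeShift_coprodProj_succ,
      ← Category.assoc, ih, hτ, Category.assoc, inj_coprodProj_of_ne hc n.succ_ne_zero.symm,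
      comp_zero, add_zero]

end Telescope

section CompactGeneration

open ZeroObject Triangulated

variable {D : Type*} [Category* D] [Preadditive D] [HasZeroObject D] [HasShift D ℤ]
  [∀ n : ℤ, (shiftFunctor D n).Additive] [Pretriangulated D]

theorem isIso_of_isColocal {Q : ObjectProperty D} [Q.IsStableUnderShift ℤ]
    (hQ : ∀ X : D, (∀ Z, Q Z → ∀ f : Z ⟶ X, f = 0) → IsZero X) {X Y : D} {u : X ⟶ Y}
    (hu : Q.isColocal u) : IsIso u := by
  obtain ⟨C, v, w, hT⟩ := distinguished_cocone_triangle u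
  have huv : u ≫ v = 0 := comp_distTriang_mor_zero₁₂ _ hT
  have hwu : w ≫ u⟦(1 : ℤ)⟧' = 0 := comp_distTriang_mor_zero₃₁ _ hT
  refine (Triangle.isZero₃_iff_isIso₁ _ hT).1 (hQ C fun Z hZ (f : Z ⟶ C) => ?_)
  have hfw : f ≫ w = 0 := by
    let adj := (shiftEquiv' D (-1 : ℤ) 1 (by simp)).toAdjunction
    apply (adj.homEquiv Z X).symm.injective
    apply (hu _ (Q.le_shift (-1 : ℤ) _ hZ)).injective
    change (adj.homEquiv Z X).symm (f ≫ w) ≫ u = (adj.homEquiv Z X).symm 0 ≫ u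
    rw [← adj.homEquiv_naturality_right_symm, ← adj.homEquiv_naturality_right_symm]
    have h : (f ≫ w) ≫ u⟦(1 : ℤ)⟧' = (0 : Z ⟶ X⟦(1 : ℤ)⟧) ≫ u⟦(1 : ℤ)⟧' := by
      rw [Category.assoc, hwu, comp_zero, zero_comp]
    exact congrArg (adj.homEquiv Z Y).symm h
  obtain ⟨g, rfl⟩ : ∃ g : Z ⟶ Y, f = g ≫ v := Triangle.coyoneda_exact₃ _ hT f hfw
  obtain ⟨h, rfl⟩ := (hu Z hZ).surjective g
  rw [Category.assoc, huv, comp_zero]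

/-- Given a weak coproduct of the `N j`, uniqueness in the universal property only has to be tested
on morphisms from generators: if `c.inj j ≫ f = 0` for all `j`, the injections lift to the fibre
of `f`, and the resulting endomorphism of `c.pt` is colocal, hence invertible. -/
theorem nonempty_isColimit_of_exists_desc {Q : ObjectProperty D} [Q.IsStableUnderShift ℤ]
    (hQ : ∀ X : D, (∀ Z, Q Z → ∀ f : Z ⟶ X, f = 0) → IsZero X) {J : Type*} {N : J → D}
    (c : Cofan N)
    (hsum : ∀ Z, Q Z → ∀ f : Z ⟶ c.pt,
      ∃ (T : Finset J) (g : ∀ j, Z ⟶ N j), f = ∑ j ∈ T, g j ≫ c.inj j)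
    (hdesc : ∀ (Y : D) (f : ∀ j, N j ⟶ Y), ∃ g : c.pt ⟶ Y, ∀ j, c.inj j ≫ g = f j) :
    Nonempty (IsColimit c) := by
  have huniq {Y : D} (f : c.pt ⟶ Y) (hf : ∀ j, c.inj j ≫ f = 0) : f = 0 := by
    obtain ⟨F, a, b, hT⟩ := distinguished_cocone_triangle₁ f
    choose l hl using fun j => Triangle.coyoneda_exact₂ _ hT (c.inj j) (hf j)
    obtain ⟨s, hs⟩ := hdesc F l
    have hsa : ∀ Z, Q Z → ∀ g : Z ⟶ c.pt, g ≫ s ≫ a = g := fun Z hZ g => by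
      obtain ⟨T, g, rfl⟩ := hsum Z hZ g
      rw [Preadditive.sum_comp]
      refine Finset.sum_congr rfl fun j _ => ?_
      rw [Category.assoc, reassoc_of% hs j]
      exact congrArg (g j ≫ ·) (hl j).symm
    have : IsIso (s ≫ a) := isIso_of_isColocal hQ fun Z hZ => by
      simp only [hsa Z hZ]
      exact Function.bijective_id
    have haf : a ≫ f = 0 := comp_distTriang_mor_zero₁₂ _ hT
    rw [← cancel_epi (s ≫ a), Category.assoc, haf, comp_zero, comp_zero]
  choose d hd using hdesc
  refine ⟨Cofan.IsColimit.mk c (fun s => d s.pt s.inj) (fun s j => hd _ _ j) fun s m hm => ?_⟩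
  exact sub_eq_zero.1 (huniq _ fun j => by rw [Preadditive.comp_sub, hd, hm, sub_self])

/-- A set of compact objects generating the triangulated category `D`: no nonzero object is right
orthogonal to it. The last condition is a smallness condition, satisfied as soon as the morphisms
from the objects of `Q` to a given object form a `t`-small set. -/
structure IsCompactGenerating (Q : ObjectProperty D) : Prop where
  le_isCompactObject : Q ≤ isCompactObject.{t} D
  isZero : ∀ X : D, (∀ Z, Q Z → ∀ f : Z ⟶ X, f = 0) → IsZero X
  exists_family : ∀ X : D, ∃ (J : Type t) (N : J → D) (φ : ∀ j, N j ⟶ X),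
    (∀ j, Q (N j)) ∧ ∀ Z, Q Z → ∀ f : Z ⟶ X, ∃ j g, f = g ≫ φ j

/-- The morphisms which factor through an object of `P`. -/
def FactorsThrough (P : ObjectProperty D) {X Y : D} (f : X ⟶ Y) : Prop :=
  ∃ (F : D) (a : X ⟶ F) (b : F ⟶ Y), P F ∧ a ≫ b = f

/-- The morphisms `τ` such that a morphism `f` from a compact object factors through an object of
`P` whenever `f ≫ τ` does. -/
def LiftsFactorizations (P : ObjectProperty D) {X Y : D} (τ : X ⟶ Y) : Prop :=
  ∀ ⦃K : D⦄, isCompactObject.{t} D K → ∀ f : K ⟶ X, FactorsThrough P (f ≫ τ) → FactorsThrough P f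

section Factorizations

variable {P Q : ObjectProperty D} [P.IsTriangulated] [P.IsClosedUnderIsomorphisms]

theorem factorsThrough_zero (X Y : D) : FactorsThrough P (0 : X ⟶ Y) :=
  ⟨0, 0, 0, P.prop_zero, zero_comp⟩

theorem FactorsThrough.add {X Y : D} {f g : X ⟶ Y} (hf : FactorsThrough P f)
    (hg : FactorsThrough P g) : FactorsThrough P (f + g) := by
  obtain ⟨F, a, b, hF, rfl⟩ := hf
  obtain ⟨F', a', b', hF', rfl⟩ := hg
  exact ⟨F ⊞ F', biprod.lift a a', biprod.desc b b',
    P.ext_of_isTriangulatedClosed₂ _ (binaryBiproductTriangle_distinguished F F') hF hF',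
    biprod.lift_desc⟩

theorem exists_mono_of_isCompactObject {K : D} (hK : isCompactObject.{t} D K) {J : Type t}
    {N : J → D} (hN : ∀ j, P (N j)) {c : Cofan N} (hc : IsColimit c) (f : K ⟶ c.pt) :
    ∃ (F : D) (a : K ⟶ F) (b : F ⟶ c.pt), P F ∧ Mono b ∧ a ≫ b = f := by
  obtain ⟨T, hT⟩ := exists_comp_coprodIdem hK hc f
  obtain ⟨b, r, hbr, hrb⟩ := exists_retract_of_coprodIdem hc T
  exact ⟨_, f ≫ r, b, P.prop_of_isLimit_fan (biproduct.isLimit _) fun j => hN j,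
    mono_of_mono_fac hbr, by rw [Category.assoc, hrb, hT]⟩

/-- Given `f : K ⟶ X` such that `f ≫ σ` factors through `E` in `P`, let `E'` be the fibre of the
composition `E ⟶ Y ⟶ c.pt⟦1⟧`, which lies in `P` because the composition has finite support. Up
to a morphism through `c.pt`, the morphism `f` factors through `E'`. -/
theorem liftsFactorizations_of_distTriang (hP : P ≤ isCompactObject.{t} D) {J : Type t}
    {N : J → D} (hN : ∀ j, P (N j)) {c : Cofan N} (hc : IsColimit c) {X Y : D} {p : c.pt ⟶ X}
    {σ : X ⟶ Y} {w : Y ⟶ c.pt⟦(1 : ℤ)⟧} (hT : Triangle.mk p σ w ∈ distTriang D) :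
    LiftsFactorizations.{t} P σ := by
  rintro K hK f ⟨E, v, s, hE, hvs⟩
  have hσw : σ ≫ w = 0 := comp_distTriang_mor_zero₂₃ _ hT
  obtain ⟨F, a, b, hF, _, hab⟩ := exists_mono_of_isCompactObject (P := P) (hP _ hE)
    (fun j => P.le_shift (1 : ℤ) _ (hN j)) (isColimitShiftCofan hc 1) (s ≫ w)
  obtain ⟨E', d, e, hE'⟩ := distinguished_cocone_triangle₁ a
  have hPE' : P E' := P.ext_of_isTriangulatedClosed₁ _ hE' hE hF
  obtain ⟨(k : E' ⟶ X), (hk : d ≫ s = k ≫ σ), -⟩ :=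
    complete_distinguished_triangle_morphism₁ _ _ hE' (distTriang_rotate hT) s b hab
  obtain ⟨v', hv'⟩ : ∃ v' : K ⟶ E', v = v' ≫ d := by
    refine Triangle.coyoneda_exact₂ _ hE' v ?_
    change v ≫ a = 0
    rw [← cancel_mono b, Category.assoc, hab, reassoc_of% hvs, hσw, comp_zero, zero_comp]
  obtain ⟨l, hl⟩ : ∃ l : K ⟶ c.pt, f - v' ≫ k = l ≫ p := by
    refine Triangle.coyoneda_exact₂ _ hT _ ?_
    change (f - v' ≫ k) ≫ σ = 0
    rw [Preadditive.sub_comp, Category.assoc, ← hk, ← Category.assoc, ← hv', hvs, sub_self]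
  obtain ⟨F', a', b', hF', -, rfl⟩ := exists_mono_of_isCompactObject hK hN hc l
  rw [← sub_add_cancel f (v' ≫ k), hl, Category.assoc]
  exact .add ⟨F', a', b' ≫ p, hF', rfl⟩ ⟨E', v', k, hPE', rfl⟩

end Factorizations

namespace IsCompactGenerating

variable {Q : ObjectProperty D}

variable [HasCoproducts.{t} D]

theorem exists_liftsFactorizations (hQ : IsCompactGenerating.{t} Q) {P : ObjectProperty D}
    [P.IsTriangulated] [P.IsClosedUnderIsomorphisms] (hP : P ≤ isCompactObject.{t} D)
    (hQP : Q ≤ P) (X : D) :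
    ∃ (Y : D) (σ : X ⟶ Y), LiftsFactorizations.{t} P σ ∧ ∀ Z, Q Z → ∀ f : Z ⟶ X, f ≫ σ = 0 := by
  obtain ⟨J, N, φ, hN, hφ⟩ := hQ.exists_family X
  obtain ⟨Y, σ, w, hT⟩ := distinguished_cocone_triangle (Limits.Sigma.desc φ)
  have hφσ : Limits.Sigma.desc φ ≫ σ = 0 := comp_distTriang_mor_zero₁₂ _ hT
  refine ⟨Y, σ, liftsFactorizations_of_distTriang hP (fun j => hQP _ (hN j))
    (coproductIsCoproduct N) hT, fun Z hZ f => ?_⟩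
  obtain ⟨j, g, rfl⟩ := hφ Z hZ f
  rw [← Limits.Sigma.ι_desc φ j, Category.assoc, Category.assoc, hφσ, comp_zero, comp_zero]

variable [Q.IsStableUnderShift ℤ]

/-- The homotopy colimit of a sequence whose transition maps kill all morphisms from generators is
zero, so that a morphism from a compact object to it vanishes at a finite stage. -/
theorem exists_eq_zero (hQ : IsCompactGenerating.{t} Q) {M : D} (hM : isCompactObject.{t} D M)
    {X : ℕ → D} {σ : ∀ n, X n ⟶ X (n + 1)} (hσ : ∀ n Z, Q Z → ∀ f : Z ⟶ X n, f ≫ σ n = 0)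
    {τ : ∀ n, M ⟶ X n} (hτ : ∀ n, τ (n + 1) = τ n ≫ σ n) : ∃ n, τ n = 0 := by
  have : HasCoproducts.{0} D := hasCoproducts_shrink.{0, t}
  obtain ⟨c, ⟨hc⟩⟩ : ∃ c : Cofan X, Nonempty (IsColimit c) := ⟨_, ⟨coproductIsCoproduct X⟩⟩
  have hs : ∀ Z, Q Z → ∀ f : Z ⟶ c.pt, f ≫ telescopeShift hc σ = 0 := fun Z hZ f => by
    obtain ⟨T, hT⟩ := exists_comp_coprodIdem_nat (hQ.le_isCompactObject _ hZ) hc f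
    rw [← hT, coprodIdem, Preadditive.comp_sum, Preadditive.sum_comp]
    refine Finset.sum_eq_zero fun n _ => ?_
    rw [Category.assoc, Category.assoc, inj_telescopeShift, ← Category.assoc (coprodProj hc n),
      ← Category.assoc, ← Category.assoc f, hσ n Z hZ, zero_comp]
  have : IsIso (𝟙 c.pt - telescopeShift hc σ) := isIso_of_isColocal hQ.isZero fun Z hZ => by
    have h : (fun f : Z ⟶ c.pt => f ≫ (𝟙 c.pt - telescopeShift hc σ)) = id := by
      ext f
      rw [Preadditive.comp_sub, hs Z hZ, sub_zero, Category.comp_id, id]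
    exact h ▸ Function.bijective_id
  let m : M ⟶ c.pt := (τ 0 ≫ c.inj 0) ≫ inv (𝟙 c.pt - telescopeShift hc σ)
  have hm : m ≫ (𝟙 c.pt - telescopeShift hc σ) = τ 0 ≫ c.inj 0 :=
    by simp only [m, Category.assoc, IsIso.inv_hom_id, Category.comp_id]
  obtain ⟨T, hT⟩ := exists_comp_coprodIdem_nat hM hc m
  obtain ⟨n, hn⟩ := Infinite.exists_notMem_finset T
  refine ⟨n, ?_⟩
  rw [← comp_coprodProj_eq_of_sub_telescopeShift hc σ hτ hm n, ← hT, Category.assoc,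
    coprodIdem_comp_coprodProj hc hn, comp_zero]

theorem exists_liftsFactorizations_zero (hQ : IsCompactGenerating.{t} Q) {P : ObjectProperty D}
    [P.IsTriangulated] [P.IsClosedUnderIsomorphisms] (hP : P ≤ isCompactObject.{t} D)
    (hQP : Q ≤ P) {M : D} (hM : isCompactObject.{t} D M) :
    ∃ Y : D, LiftsFactorizations.{t} P (0 : M ⟶ Y) := by
  choose next σ hσ hσ₀ using hQ.exists_liftsFactorizations hP hQP
  let X (n : ℕ) : D := Nat.rec M (fun _ Y => next Y) n
  let τ (n : ℕ) : M ⟶ X n := Nat.rec (𝟙 M) (fun n f => f ≫ σ (X n)) n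
  have hτ (n : ℕ) : LiftsFactorizations.{t} P (τ n) := by
    induction n with
    | zero => exact fun K _ f hf => by rwa [← Category.comp_id f]
    | succ n ih => exact fun K hK f hf => ih hK f (hσ _ hK _ (by rwa [Category.assoc]))
  obtain ⟨n, hn⟩ := hQ.exists_eq_zero hM (σ := fun n => σ (X n)) (fun n => hσ₀ (X n))
    (τ := τ) fun _ => rfl
  exact ⟨X n, hn ▸ hτ n⟩

theorem isCompactObject_eq_triangEnvelope [IsTriangulated D] [Q.Nonempty]
    (hQ : IsCompactGenerating.{t} Q) : isCompactObject.{t} D = Q.triangEnvelope := by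
  have hQ' : Q.triangEnvelope ≤ isCompactObject.{t} D :=
    Q.triangEnvelope_le_iff.2 hQ.le_isCompactObject
  refine le_antisymm (fun M hM => ?_) hQ'
  obtain ⟨Y, hY⟩ := hQ.exists_liftsFactorizations_zero hQ' Q.le_triangEnvelope hM
  obtain ⟨F, a, b, hF, hab⟩ := hY hM (𝟙 M) (by
    rw [comp_zero]
    exact factorsThrough_zero M Y)
  exact Q.triangEnvelope.prop_of_retract ⟨a, b, hab⟩ hF

end IsCompactGenerating

end CompactGeneration

section DerivedCategory

open DerivedCategory

section Generators

variable {C : Type*} [Category* C] [Abelian C] {ι : Type*} (G : ι → C)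

/-- A family of projective generators of an abelian category, the generation property being that
no nonzero object is right orthogonal to the family. -/
structure IsProjGenerating : Prop where
  projective : ∀ i, Projective (G i)
  isZero : ∀ X : C, (∀ i (f : G i ⟶ X), f = 0) → IsZero X

/-- A family of projective generators consisting of compact objects. -/
structure IsCompactProjGenerating : Prop extends IsProjGenerating G where
  isCompactObject : ∀ i, isCompactObject.{t} C (G i)

variable {G}

theorem IsProjGenerating.exact_of_forall_exists (hG : IsProjGenerating G) (S : ShortComplex C)
    (hS : ∀ i (x : G i ⟶ S.X₂), x ≫ S.g = 0 → ∃ y, y ≫ S.f = x) : S.Exact := by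
  rw [S.exact_iff_isZero_homology]
  refine hG.isZero _ fun i f => ?_
  have := hG.projective i
  obtain ⟨y, hy⟩ := hS i (Projective.factorThru f S.homologyπ ≫ S.iCycles) (by
    rw [Category.assoc, S.iCycles_g, comp_zero])
  have hy' : y ≫ S.toCycles = Projective.factorThru f S.homologyπ := by
    rw [← cancel_mono S.iCycles, Category.assoc, S.toCycles_i, hy]
  rw [← Projective.factorThru_comp f S.homologyπ, ← hy', Category.assoc,
    S.toCycles_comp_homologyπ, comp_zero]

end Generators

section KProjective

variable {C : Type*} [Category* C] [Abelian C]

instance {P : C} [Projective P] (k : ℤ) :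
    CochainComplex.IsKProjective ((HomologicalComplex.single C (ComplexShape.up ℤ) k).obj P) := by
  have : ∀ n, Projective (((HomologicalComplex.single C (ComplexShape.up ℤ) k).obj P).X n) := by
    intro n
    obtain rfl | hn := eq_or_ne n k
    · exact Projective.of_iso (HomologicalComplex.singleObjXSelf (ComplexShape.up ℤ) n P).symm ‹_›
    · exact (HomologicalComplex.isZero_single_obj_X (ComplexShape.up ℤ) k P n hn).projective
  have : CochainComplex.IsStrictlyLE
      ((HomologicalComplex.single C (ComplexShape.up ℤ) k).obj P) k :=
    inferInstanceAs (CochainComplex.IsStrictlyLE ((CochainComplex.singleFunctor C k).obj P) k)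
  exact CochainComplex.isKProjective_of_projective _ k

variable [HasDerivedCategory.{w} C] {K L : CochainComplex C ℤ} [K.IsKProjective]

theorem Q_map_surjective : Function.Surjective (Q.map : (K ⟶ L) → (Q.obj K ⟶ Q.obj L)) := by
  intro f
  obtain ⟨a, ha⟩ := (CochainComplex.IsKProjective.Qh_map_bijective K
    ((HomotopyCategory.quotient _ _).obj L)).surjective
    ((quotientCompQhIso C).hom.app K ≫ f ≫ (quotientCompQhIso C).inv.app L)
  obtain ⟨φ, rfl⟩ := (HomotopyCategory.quotient _ _).map_surjective a
  have hφ := quotientCompQhIso_hom_naturality φ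
  rw [ha] at hφ
  refine ⟨φ, ?_⟩
  rw [← cancel_epi ((quotientCompQhIso C).hom.app K), ← hφ]
  simp

theorem nonempty_homotopy_of_Q_map_eq_zero {φ : K ⟶ L} (hφ : Q.map φ = 0) :
    Nonempty (Homotopy φ 0) := by
  have h := quotientCompQhIso_hom_naturality φ
  rw [hφ, comp_zero] at h
  refine ⟨HomotopyCategory.homotopyOfEq _ _
    ((CochainComplex.IsKProjective.Qh_map_bijective K _).injective ?_)⟩
  rw [Functor.map_zero, Functor.map_zero, ← cancel_mono ((quotientCompQhIso C).hom.app L),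
    zero_comp]
  exact h

end KProjective

section Detection

variable {C : Type*} [Category* C] [Abelian C] [HasDerivedCategory.{w} C] {ι : Type*} {G : ι → C}

theorem isZero_Q_obj_of_acyclic {K : CochainComplex C ℤ} (hK : K.Acyclic) : IsZero (Q.obj K) := by
  have : QuasiIso (0 : K ⟶ K) := ⟨fun n => (quasiIsoAt_iff_exactAt _ n (hK n)).2 (hK n)⟩
  have h : IsIso (Q.map (0 : K ⟶ K)) := inferInstance
  rw [Q.map_zero] at h
  rw [IsZero.iff_id_eq_zero, ← IsIso.hom_inv_id (0 : Q.obj K ⟶ Q.obj K), zero_comp]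

/-- A cycle `x : G i ⟶ K.X k` is a morphism of complexes from `G i` placed in degree `k`; if this
morphism is null-homotopic, then `x` is a boundary. -/
theorem IsProjGenerating.acyclic (hG : IsProjGenerating G) {K : CochainComplex C ℤ}
    (hK : ∀ i k (f : (singleFunctor C k).obj (G i) ⟶ Q.obj K), f = 0) : K.Acyclic := fun k => by
  rw [K.exactAt_iff' (k - 1) k (k + 1) (by simp) (by simp)]
  refine hG.exact_of_forall_exists _
    fun i (x : G i ⟶ K.X k) (hx : x ≫ K.d k (k + 1) = 0) => ?_
  have := hG.projective i
  obtain ⟨φ, hφk⟩ : ∃ φ : (HomologicalComplex.single C (ComplexShape.up ℤ) k).obj (G i) ⟶ K,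
      (HomologicalComplex.singleObjXSelf (ComplexShape.up ℤ) k (G i)).inv ≫ φ.f k = x :=
    ⟨HomologicalComplex.mkHomFromSingle x fun l hl => by obtain rfl : k + 1 = l := hl; exact hx,
      by simp⟩
  have hφ : Q.map φ = 0 := hK i k (Q.map φ)
  obtain ⟨h⟩ := nonempty_homotopy_of_Q_map_eq_zero hφ
  have hcomm := h.comm k
  rw [HomologicalComplex.zero_f, add_zero, dNext_eq _ (show k + 1 = k + 1 from rfl),
    prevD_eq _ (show k - 1 + 1 = k by lia), HomologicalComplex.single_obj_d, zero_comp, zero_add]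
    at hcomm
  refine ⟨(HomologicalComplex.singleObjXSelf (ComplexShape.up ℤ) k (G i)).inv ≫ h.hom k (k - 1), ?_⟩
  exact (Category.assoc _ _ _).trans ((congrArg _ hcomm.symm).trans hφk)

variable (G) in
/-- The objects of the derived category isomorphic to a generator `G i` placed in some degree. -/
def shiftedGenerators : ObjectProperty (DerivedCategory C) := fun X =>
  ∃ i k, Nonempty (X ≅ (singleFunctor C k).obj (G i))

instance : (shiftedGenerators G).IsStableUnderShift ℤ where
  isStableUnderShiftBy n := ⟨fun _ ⟨i, k, ⟨e⟩⟩ => ⟨i, k - n, ⟨(shiftFunctor _ n).mapIso e ≪≫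
    ((singleFunctors C).shiftIso n (k - n) k (by lia)).app (G i)⟩⟩⟩

instance [Nonempty ι] : (shiftedGenerators G).Nonempty :=
  ⟨(singleFunctor C 0).obj (G (Classical.arbitrary ι)), _, _, ⟨Iso.refl _⟩⟩

theorem IsProjGenerating.isZero_of_shiftedGenerators (hG : IsProjGenerating G)
    (X : DerivedCategory C) (hX : ∀ Z, shiftedGenerators G Z → ∀ f : Z ⟶ X, f = 0) : IsZero X := by
  refine IsZero.of_iso (isZero_Q_obj_of_acyclic (hG.acyclic fun i k f => ?_))
    (Q.objObjPreimageIso X).symm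
  rw [← cancel_mono (Q.objObjPreimageIso X).hom, zero_comp]
  exact hX _ ⟨i, k, ⟨Iso.refl _⟩⟩ _

end Detection

section Coproducts

variable {C : Type*} [Category* C] [Abelian C]

theorem Q_map_coprodIdem [HasDerivedCategory.{w} C] {J : Type*} {K : J → CochainComplex C ℤ}
    {c : Cofan K} (hc : IsColimit c) (T : Finset J) :
    Q.map (coprodIdem hc T) = ∑ j ∈ T, Q.map (coprodProj hc j) ≫ Q.map (c.inj j) := by
  simp only [coprodIdem, Q.map_sum, Q.map_comp]

variable [HasCoproducts.{t} C]

theorem isCompactObject_single {P : C} (hP : isCompactObject.{t} C P) (k : ℤ) :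
    isCompactObject.{t} (CochainComplex C ℤ)
      ((HomologicalComplex.single C (ComplexShape.up ℤ) k).obj P) := by
  refine isCompactObject_iff.2 fun J K c hc f => ?_
  have hc' := isColimitCofanMkObjOfIsColimit (HomologicalComplex.eval C (ComplexShape.up ℤ) k) _ _
    (hc.ofIsoColimit (Cofan.ext (Iso.refl _)) : IsColimit (Cofan.mk c.pt c.inj))
  obtain ⟨T, hT⟩ := exists_comp_coprodIdem hP hc'
    ((HomologicalComplex.singleObjXSelf (ComplexShape.up ℤ) k P).inv ≫ f.f k)
  refine ⟨T, HomologicalComplex.from_single_hom_ext ?_⟩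
  rw [← cancel_epi (HomologicalComplex.singleObjXSelf (ComplexShape.up ℤ) k P).inv,
    HomologicalComplex.comp_f, ← Category.assoc]
  exact (congrArg (_ ≫ ·) (map_coprodIdem hc _ hc' T)).trans hT

variable [HasDerivedCategory.{w} C] {J : Type t} {K : J → CochainComplex C ℤ} {c : Cofan K}
  (hc : IsColimit c)

theorem exists_comp_Q_map_coprodIdem {P : C} [Projective P] (hP : isCompactObject.{t} C P) {k : ℤ}
    (f : (singleFunctor C k).obj P ⟶ Q.obj c.pt) :
    ∃ T : Finset J, f ≫ Q.map (coprodIdem hc T) = f := by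
  obtain ⟨φ, rfl⟩ :=
    Q_map_surjective (K := (HomologicalComplex.single C (ComplexShape.up ℤ) k).obj P) f
  obtain ⟨T, hT⟩ := exists_comp_coprodIdem (isCompactObject_single hP k) hc φ
  exact ⟨T, (Q.map_comp _ _).symm.trans (congrArg Q.map hT)⟩

variable {ι : Type*} {G : ι → C}

theorem IsCompactProjGenerating.exists_comp_Q_map_coprodIdem (hG : IsCompactProjGenerating.{t} G)
    {Z : DerivedCategory C} (hZ : shiftedGenerators G Z) (f : Z ⟶ Q.obj c.pt) :
    ∃ T : Finset J, f ≫ Q.map (coprodIdem hc T) = f := by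
  obtain ⟨i, k, ⟨e⟩⟩ := hZ
  have := hG.projective i
  obtain ⟨T, hT⟩ := _root_.exists_comp_Q_map_coprodIdem hc (hG.isCompactObject i) (e.inv ≫ f)
  exact ⟨T, by rwa [Category.assoc, cancel_epi] at hT⟩

theorem IsCompactProjGenerating.isIso_Q_map_desc (hG : IsCompactProjGenerating.{t} G)
    (hc : IsColimit c) {K' : J → CochainComplex C ℤ} {c' : Cofan K'} (hc' : IsColimit c')
    (s : ∀ j, K' j ⟶ K j) [∀ j, IsIso (Q.map (s j))] :
    IsIso (Q.map (Cofan.IsColimit.desc hc' fun j => s j ≫ c.inj j)) := by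
  set σ := Cofan.IsColimit.desc hc' fun j => s j ≫ c.inj j
  have hinj (j : J) : c'.inj j ≫ σ = s j ≫ c.inj j := Cofan.IsColimit.fac hc' _ j
  have hproj (j : J) : σ ≫ coprodProj hc j = coprodProj hc' j ≫ s j :=
    Cofan.IsColimit.hom_ext hc' _ _ fun l => by
      rw [reassoc_of% hinj]
      obtain rfl | hlj := eq_or_ne l j
      · rw [inj_coprodProj_self, Category.comp_id, reassoc_of% inj_coprodProj_self hc' l]
      · rw [inj_coprodProj_of_ne hc hlj, comp_zero, reassoc_of% inj_coprodProj_of_ne hc' hlj,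
          zero_comp]
  refine isIso_of_isColocal hG.isZero_of_shiftedGenerators fun Z hZ => ⟨?_, fun f => ?_⟩
  · refine (injective_iff_map_eq_zero (Preadditive.rightComp Z (Q.map σ))).2 fun f hf => ?_
    change f ≫ Q.map σ = 0 at hf
    obtain ⟨T, hT⟩ := hG.exists_comp_Q_map_coprodIdem hc' hZ f
    rw [← hT, Q_map_coprodIdem, Preadditive.comp_sum]
    refine Finset.sum_eq_zero fun j _ => ?_
    have hfj : f ≫ Q.map (coprodProj hc' j) = 0 := by
      rw [← cancel_mono (Q.map (s j)), Category.assoc, ← Q.map_comp, ← hproj, Q.map_comp,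
        reassoc_of% hf, zero_comp, zero_comp]
    rw [reassoc_of% hfj, zero_comp]
  · obtain ⟨T, hT⟩ := hG.exists_comp_Q_map_coprodIdem hc hZ f
    refine ⟨∑ j ∈ T, f ≫ Q.map (coprodProj hc j) ≫ inv (Q.map (s j)) ≫ Q.map (c'.inj j), ?_⟩
    conv_rhs => rw [← hT, Q_map_coprodIdem, Preadditive.comp_sum]
    refine (Preadditive.sum_comp _ _ _).trans (Finset.sum_congr rfl fun j _ => ?_)
    simp only [Category.assoc]
    rw [← Q.map_comp, hinj, Q.map_comp, IsIso.inv_hom_id_assoc]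

theorem IsCompactProjGenerating.exists_Q_desc (hG : IsCompactProjGenerating.{t} G)
    (hc : IsColimit c) {Y : DerivedCategory C} (f : ∀ j, Q.obj (K j) ⟶ Y) :
    ∃ g : Q.obj c.pt ⟶ Y, ∀ j, Q.map (c.inj j) ≫ g = f j := by
  choose K' s hs g hg using fun j => right_fac (f j ≫ (Q.objObjPreimageIso Y).inv)
  let hc' := coproductIsCoproduct K'
  let σ := Cofan.IsColimit.desc hc' fun j => s j ≫ c.inj j
  have : IsIso (Q.map σ) := hG.isIso_Q_map_desc hc hc' s
  refine ⟨inv (Q.map σ) ≫ Q.map (Cofan.IsColimit.desc hc' g) ≫ (Q.objObjPreimageIso Y).hom,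
    fun j => ?_⟩
  have hinj : Q.map (c.inj j) ≫ inv (Q.map σ) = inv (Q.map (s j)) ≫ Q.map (Sigma.ι K' j) := by
    rw [IsIso.comp_inv_eq, Category.assoc, ← Q.map_comp, IsIso.eq_inv_comp, ← Q.map_comp]
    exact congrArg Q.map (Cofan.IsColimit.fac hc' (fun j => s j ≫ c.inj j) j).symm
  have hdesc : Sigma.ι K' j ≫ Cofan.IsColimit.desc hc' g = g j := Cofan.IsColimit.fac hc' g j
  rw [reassoc_of% hinj, ← Q.map_comp_assoc, hdesc, ← Category.assoc, ← hg, Category.assoc,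
    Iso.inv_hom_id, Category.comp_id]

theorem IsCompactProjGenerating.nonempty_isColimit_Q (hG : IsCompactProjGenerating.{t} G)
    (hc : IsColimit c) :
    Nonempty (IsColimit (Cofan.mk (Q.obj c.pt) fun j => Q.map (c.inj j))) := by
  refine nonempty_isColimit_of_exists_desc hG.isZero_of_shiftedGenerators _ (fun Z hZ f => ?_)
    fun Y f => hG.exists_Q_desc hc f
  obtain ⟨T, hT⟩ := hG.exists_comp_Q_map_coprodIdem hc hZ f
  refine ⟨T, fun j => f ≫ Q.map (coprodProj hc j), ?_⟩
  conv_lhs => rw [← hT, Q_map_coprodIdem, Preadditive.comp_sum]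
  exact Finset.sum_congr rfl fun j _ => (Category.assoc _ _ _).symm

theorem IsCompactProjGenerating.hasCoproducts (hG : IsCompactProjGenerating.{t} G) :
    HasCoproducts.{t} (DerivedCategory C) := by
  intro J
  have : ∀ N : J → DerivedCategory C, HasCoproduct N := fun N => by
    obtain ⟨h⟩ := hG.nonempty_isColimit_Q (coproductIsCoproduct fun j => Q.objPreimage (N j))
    have : HasCoproduct fun j => Q.obj (Q.objPreimage (N j)) := ⟨⟨⟨_, h⟩⟩⟩
    exact hasColimit_of_iso (F := Discrete.functor fun j => Q.obj (Q.objPreimage (N j)))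
      (Discrete.natIso fun j => (Q.objObjPreimageIso (N j.as)).symm)
  exact ⟨fun F => hasColimit_of_iso (Discrete.natIsoFunctor (F := F))⟩

theorem isCompactObject_singleFunctor (hG : IsCompactProjGenerating.{t} G) {P : C} [Projective P]
    (hP : isCompactObject.{t} C P) (k : ℤ) :
    isCompactObject.{t} (DerivedCategory C) ((singleFunctor C k).obj P) := by
  refine isCompactObject_iff.2 fun J N c hc f => ?_
  let K (j : J) := Q.objPreimage (N j)
  let e (j : J) : Q.obj (K j) ≅ N j := Q.objObjPreimageIso (N j)
  let d := Cofan.mk (∐ K) (Sigma.ι K)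
  have hd : IsColimit d := coproductIsCoproduct K
  obtain ⟨h⟩ := hG.nonempty_isColimit_Q hd
  let σ : c.pt ⟶ Q.obj (∐ K) := Cofan.IsColimit.desc hc fun j => (e j).inv ≫ Q.map (d.inj j)
  let τ : Q.obj (∐ K) ⟶ c.pt := Cofan.IsColimit.desc h fun j => (e j).hom ≫ c.inj j
  have hσ (j : J) : c.inj j ≫ σ = (e j).inv ≫ Q.map (d.inj j) := Cofan.IsColimit.fac hc _ j
  have hτ (j : J) : Q.map (d.inj j) ≫ τ = (e j).hom ≫ c.inj j := Cofan.IsColimit.fac h _ j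
  have hστ : σ ≫ τ = 𝟙 _ := Cofan.IsColimit.hom_ext hc _ _ fun j => by
    rw [reassoc_of% hσ, hτ, Iso.inv_hom_id_assoc, Category.comp_id]
  obtain ⟨T, hT⟩ := _root_.exists_comp_Q_map_coprodIdem hd hP (f ≫ σ)
  refine ⟨T, comp_coprodIdem_of_eq_sum hc
    (g := fun j => f ≫ σ ≫ Q.map (coprodProj hd j) ≫ (e j).hom) ?_⟩
  conv_lhs => rw [← Category.comp_id f, ← hστ, ← Category.assoc, ← hT, Q_map_coprodIdem,
    Preadditive.comp_sum, Preadditive.sum_comp]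
  simp only [Category.assoc, hτ]

end Coproducts
end DerivedCategory

section GrothendieckGroups

section Presentation

variable {R : Type*} [Ring R] {α : Type*} {U : Set (α →₀ R)}
  {H : Type*} [AddCommGroup H] [Module R H]

variable (U) in
/-- The class of the generator `a` in the `R`-module with generators `α` and relations `U`. The
classes `[P]` and `[M]` in Grothendieck groups are of this form. -/
noncomputable def presentedClass (a : α) : (α →₀ R) ⧸ Submodule.span R U :=
  Submodule.Quotient.mk (Finsupp.single a 1)

theorem linearCombination_presentedClass :
    Finsupp.linearCombination R (presentedClass U) = (Submodule.span R U).mkQ :=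
  Finsupp.lhom_ext' fun a => LinearMap.ext_ring <| by
    rw [LinearMap.comp_apply, Finsupp.lsingle_apply, Finsupp.linearCombination_single, one_smul]
    rfl

theorem linearCombination_presentedClass_eq_zero {r : α →₀ R} (hr : r ∈ U) :
    Finsupp.linearCombination R (presentedClass U) r = 0 := by
  rw [linearCombination_presentedClass]
  exact (Submodule.Quotient.mk_eq_zero _).2 (Submodule.subset_span hr)

/-- The linear map out of the module with generators `α` and relations `U` which is given by a
function on the generators satisfying the relations. -/
noncomputable def presentedLift (f : α → H) (hf : ∀ r ∈ U, Finsupp.linearCombination R f r = 0) :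
    ((α →₀ R) ⧸ Submodule.span R U) →ₗ[R] H :=
  (Submodule.span R U).liftQ (Finsupp.linearCombination R f) (Submodule.span_le.2 hf)

theorem presentedLift_presentedClass (f : α → H)
    (hf : ∀ r ∈ U, Finsupp.linearCombination R f r = 0) (a : α) :
    presentedLift f hf (presentedClass U a) = f a :=
  (Finsupp.linearCombination_single R 1 a).trans (one_smul R _)

theorem presented_hom_ext {f g : ((α →₀ R) ⧸ Submodule.span R U) →ₗ[R] H}
    (h : ∀ a, f (presentedClass U a) = g (presentedClass U a)) : f = g :=
  Submodule.linearMap_qext _ (Finsupp.lhom_ext' fun a => LinearMap.ext_ring (h a))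

end Presentation

section SplitAdditive

variable {C : Type*} [Category* C] [Preadditive C] [HasBinaryBiproducts C] {P : ObjectProperty C}
  {H : Type*} [AddCommGroup H]

/-- An invariant of the objects in `P` which is additive on direct sums. -/
def IsSplitAdditive (f : P.FullSubcategory → H) : Prop :=
  ∀ X Y Z : P.FullSubcategory, Nonempty (X.obj ≅ Y.obj ⊞ Z.obj) → f X = f Y + f Z

theorem isSplitAdditive_iff (R : Type) [Ring R] [Module R H] {f : P.FullSubcategory → H} :
    IsSplitAdditive f ↔ ∀ r ∈ directSumRelations R P, Finsupp.linearCombination R f r = 0 := by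
  have h (X Y Z : P.FullSubcategory) : f X = f Y + f Z ↔
      Finsupp.linearCombination R f (.single X 1 - .single Y 1 - .single Z 1) = 0 := by
    simp only [map_sub, Finsupp.linearCombination_single, one_smul]
    rw [sub_sub, sub_eq_zero]
  refine ⟨?_, fun hf X Y Z e => (h X Y Z).2 (hf _ ⟨X, Y, Z, e, rfl⟩)⟩
  rintro hf _ ⟨X, Y, Z, e, rfl⟩
  exact (h X Y Z).1 (hf X Y Z e)

theorem IsSplitAdditive.eq_of_iso {f : P.FullSubcategory → H} (hf : IsSplitAdditive f)
    {X Y Z : P.FullSubcategory} (hZ : IsZero Z.obj) (e : X.obj ≅ Y.obj) : f X = f Y := by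
  have e' : Y.obj ≅ Y.obj ⊞ Z.obj := ⟨biprod.inl, biprod.fst, by simp,
    biprod.hom_ext' _ _ (by simp) (hZ.eq_of_src _ _)⟩
  rw [hf X Y Z ⟨e ≪≫ e'⟩, ← hf Y Y Z ⟨e'⟩]

end SplitAdditive

section ShiftEquivariant

variable {C : Type*} [Category* C] {P : ObjectProperty C} {S : ℤ → C ⥤ C} {H : Type*}
  [AddCommGroup H] [Module ℤ[T;T⁻¹] H]

variable (S) in
/-- An invariant of the objects in `P` on which the functor `S n` acts as multiplication by
`T n`. -/
def IsShiftEquivariant (f : P.FullSubcategory → H) : Prop :=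
  ∀ (n : ℤ) (X Y : P.FullSubcategory), Nonempty (Y.obj ≅ (S n).obj X.obj) →
    f Y = (LaurentPolynomial.T n : ℤ[T;T⁻¹]) • f X

theorem isShiftEquivariant_iff {f : P.FullSubcategory → H} :
    IsShiftEquivariant S f ↔
      ∀ r ∈ shiftRelations P S, Finsupp.linearCombination ℤ[T;T⁻¹] f r = 0 := by
  have h (n : ℤ) (X Y : P.FullSubcategory) :
      f Y = (LaurentPolynomial.T n : ℤ[T;T⁻¹]) • f X ↔
        Finsupp.linearCombination ℤ[T;T⁻¹] f
          (.single Y 1 - .single X (LaurentPolynomial.T n)) = 0 := by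
    simp only [map_sub, Finsupp.linearCombination_single, one_smul, sub_eq_zero]
  refine ⟨?_, fun hf n X Y e => (h n X Y).2 (hf _ ⟨n, X, Y, e, rfl⟩)⟩
  rintro hf _ ⟨n, X, Y, e, rfl⟩
  exact (h n X Y).1 (hf n X Y e)

end ShiftEquivariant

section TriangleAdditive

open ZeroObject

variable {D : Type*} [Category* D] [Preadditive D] [HasZeroObject D] [HasShift D ℤ]
  [∀ n : ℤ, (shiftFunctor D n).Additive] [Pretriangulated D] {P : ObjectProperty D}
  {K : Type*} [AddCommGroup K]

/-- An invariant of the objects in `P` which is additive on distinguished triangles and changes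
sign under the shift. -/
structure IsTriangleAdditive (κ : P.FullSubcategory → K) : Prop where
  eq_add : ∀ T ∈ distTriang D, ∀ (h₁ : P T.obj₁) (h₂ : P T.obj₂) (h₃ : P T.obj₃),
    κ ⟨T.obj₂, h₂⟩ = κ ⟨T.obj₁, h₁⟩ + κ ⟨T.obj₃, h₃⟩
  shift_one : ∀ (X : D) (h : P X) (h' : P (X⟦(1 : ℤ)⟧)), κ ⟨X⟦(1 : ℤ)⟧, h'⟩ = -κ ⟨X, h⟩

theorem isTriangleAdditive_iff (R : Type) [Ring R] [Module R K] {κ : P.FullSubcategory → K} :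
    IsTriangleAdditive κ ↔
      ∀ r ∈ triangleRelations R P, Finsupp.linearCombination R κ r = 0 := by
  have h₁ (X Y Z : P.FullSubcategory) : κ Y = κ X + κ Z ↔
      Finsupp.linearCombination R κ (.single Y 1 - .single X 1 - .single Z 1) = 0 := by
    simp only [map_sub, Finsupp.linearCombination_single, one_smul]
    rw [sub_sub, sub_eq_zero]
  have h₂ (X Y : P.FullSubcategory) : κ Y = -κ X ↔
      Finsupp.linearCombination R κ (.single Y 1 + .single X 1) = 0 := by
    simp only [map_add, Finsupp.linearCombination_single, one_smul, eq_neg_iff_add_eq_zero]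
  constructor
  · rintro hκ _ (⟨T, hT, hX, hY, hZ, rfl⟩ | ⟨X, hX, hX', rfl⟩)
    · exact (h₁ _ _ _).1 (hκ.eq_add T hT hX hY hZ)
    · exact (h₂ _ _).1 (hκ.shift_one X hX hX')
  · exact fun hκ =>
      ⟨fun T hT hX hY hZ => (h₁ _ _ _).2 (hκ _ (Or.inl ⟨T, hT, hX, hY, hZ, rfl⟩)),
        fun X hX hX' => (h₂ _ _).2 (hκ _ (Or.inr ⟨X, hX, hX', rfl⟩))⟩

namespace IsTriangleAdditive

variable {κ : P.FullSubcategory → K} (hκ : IsTriangleAdditive κ)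

include hκ

theorem eq_add_of_distTriang {X Y Z : D} {f : X ⟶ Y} {g : Y ⟶ Z} {h : Z ⟶ X⟦(1 : ℤ)⟧}
    (hT : Triangle.mk f g h ∈ distTriang D) (hX : P X) (hY : P Y) (hZ : P Z) :
    κ ⟨Y, hY⟩ = κ ⟨X, hX⟩ + κ ⟨Z, hZ⟩ :=
  hκ.eq_add _ hT hX hY hZ

theorem isSplitAdditive {C : Type*} [Category* C] [Preadditive C] [HasBinaryBiproducts C]
    {Q : ObjectProperty C} (F : C ⥤ D) [F.Additive]
    (hF : ∀ X : Q.FullSubcategory, P (F.obj X.obj)) :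
    IsSplitAdditive fun X : Q.FullSubcategory => κ ⟨F.obj X.obj, hF X⟩ := by
  rintro X Y Z ⟨e⟩
  have := preservesBinaryBiproducts_of_preservesBiproducts F
  exact hκ.eq_add_of_distTriang (distTriang_congr₂
    (binaryBiproductTriangle_distinguished (F.obj Y.obj) (F.obj Z.obj))
    ((F.mapBiprod _ _).symm ≪≫ F.mapIso e.symm)) _ _ _

theorem eq_of_iso [P.IsClosedUnderIsomorphisms] [P.ContainsZero] {X Y : P.FullSubcategory}
    (e : X.obj ≅ Y.obj) : κ X = κ Y := by
  have h₁ := hκ.eq_add_of_distTriang (contractible_distinguished Y.obj) Y.property Y.property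
    P.prop_zero
  have h₂ := hκ.eq_add_of_distTriang
    (distTriang_congr₁ (contractible_distinguished Y.obj) e.symm) X.property Y.property P.prop_zero
  exact add_right_cancel (h₂.symm.trans h₁)

variable [P.IsClosedUnderIsomorphisms] [P.IsTriangulated]

theorem shift_natCast {M : D} (hM : P M) (k : ℕ) (hk : P (M⟦(k : ℤ)⟧)) :
    κ ⟨M⟦(k : ℤ)⟧, hk⟩ = (-1 : ℤ) ^ k • κ ⟨M, hM⟩ := by
  induction k with
  | zero =>
    rw [pow_zero, one_smul]
    exact hκ.eq_of_iso ((shiftFunctorZero' D (0 : ℤ) rfl).app M)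
  | succ k ih =>
    have hk' : P (M⟦(k : ℤ)⟧) := P.le_shift (k : ℤ) M hM
    rw [pow_succ, mul_neg_one, neg_smul, ← ih hk',
      ← hκ.shift_one _ _ (P.le_shift (1 : ℤ) _ hk')]
    exact hκ.eq_of_iso ((shiftFunctorAdd' D (k : ℤ) 1 ((k + 1 : ℕ) : ℤ) (by simp)).app M)

variable {G : Type*} [AddCommGroup G] {S : PresiltingInvariant D G} {Φ : G →+ K}

theorem eq_of_hasResolution (hP : ∀ X, S.P X → ∃ h : P X, κ ⟨X, h⟩ = Φ (S.cl X)) {n : ℕ}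
    {M : D} {x : G} (h : S.HasResolution n M x) (hM : P M) : κ ⟨M, hM⟩ = Φ x := by
  induction h with
  | zero h => exact (hP _ h).2
  | succ hX hT _ ih =>
    obtain ⟨hX', hX⟩ := hP _ hX
    have hN := P.ext_of_isTriangulatedClosed₁ _ hT hX' hM
    rw [map_sub, ← hX, ← ih hN, hκ.eq_add_of_distTriang hT hN hX' hM, add_sub_cancel_left]

theorem eq_of_hasEulerChar (hP : ∀ X, S.P X → ∃ h : P X, κ ⟨X, h⟩ = Φ (S.cl X)) {M : D} {x : G}
    (h : S.HasEulerChar M x) (hM : P M) : κ ⟨M, hM⟩ = Φ x := by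
  obtain ⟨k, n, h⟩ := h
  have hk : P (M⟦(k : ℤ)⟧) := P.le_shift (k : ℤ) M hM
  have h' := hκ.eq_of_hasResolution hP h hk
  rw [hκ.shift_natCast hM k hk, map_zsmul] at h'
  rcases neg_one_pow_eq_or ℤ k with h | h <;> rw [h] at h' <;> simpa using h'

end IsTriangleAdditive

namespace PresiltingInvariant

variable {G : Type*} [AddCommGroup G] {S : PresiltingInvariant D G}

/-- The Euler characteristic of an object, some shift of which has a finite resolution by objects
of `S.P`. -/
noncomputable def eulerChar {M : D} (hM : S.resolvable M) : G := hM.choose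

theorem hasEulerChar_eulerChar {M : D} (hM : S.resolvable M) :
    S.HasEulerChar M (eulerChar hM) := hM.choose_spec

variable [IsTriangulated D]

theorem isTriangleAdditive_eulerChar (hP : P ≤ S.resolvable) :
    IsTriangleAdditive fun M : P.FullSubcategory => eulerChar (hP _ M.property) where
  eq_add T hT h₁ h₂ h₃ :=
    (hasEulerChar_eulerChar (hP _ h₂)).unique
      ((hasEulerChar_eulerChar (hP _ h₁)).of_distTriang (hasEulerChar_eulerChar (hP _ h₃))
        (f := T.mor₁) (g := T.mor₂) (h := T.mor₃) hT)
  shift_one _ h h' :=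
    (hasEulerChar_eulerChar (hP _ h')).unique (hasEulerChar_eulerChar (hP _ h)).shift_one

end PresiltingInvariant

end TriangleAdditive

end GrothendieckGroups

section CompactProjClass

open DerivedCategory PresiltingInvariant

section Single

variable {C : Type*} [Category* C] [Abelian C] [HasDerivedCategory.{w} C]

theorem single_hom_eq_zero {P P' : C} [Projective P] {k l : ℤ} (hkl : k ≠ l)
    (f : (singleFunctor C k).obj P ⟶ (singleFunctor C l).obj P') : f = 0 := by
  obtain ⟨φ, rfl⟩ := Q_map_surjective
    (K := (HomologicalComplex.single C (ComplexShape.up ℤ) k).obj P)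
    (L := (HomologicalComplex.single C (ComplexShape.up ℤ) l).obj P') f
  have hφ : φ = 0 := HomologicalComplex.from_single_hom_ext
    ((HomologicalComplex.isZero_single_obj_X (ComplexShape.up ℤ) l P' k hkl).eq_of_tgt _ _)
  rw [hφ]
  exact Q.map_zero _ _

theorem exists_iso_single_of_retract {X : DerivedCategory C} {P : C} {k : ℤ}
    (r : Retract X ((singleFunctor C k).obj P)) :
    ∃ (P' : C) (_ : Retract P' P), Nonempty (X ≅ (singleFunctor C k).obj P') := by
  obtain ⟨p, hp⟩ := (singleFunctor C k).map_surjective (r.r ≫ r.i)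
  obtain ⟨P', i, e, hie, hei⟩ := IsIdempotentComplete.idempotents_split P p
    ((singleFunctor C k).map_injective (by rw [Functor.map_comp, hp]; simp))
  refine ⟨P', ⟨i, e, hie⟩,
    ⟨⟨r.i ≫ (singleFunctor C k).map e, (singleFunctor C k).map i ≫ r.r, ?_, ?_⟩⟩⟩
  · rw [Category.assoc, ← Functor.map_comp_assoc, hei, hp]
    simp
  · rw [Category.assoc, ← Category.assoc r.r, ← hp, ← Functor.map_comp, ← Functor.map_comp, ← hei,
      Category.assoc, hie, Category.comp_id, hie, CategoryTheory.Functor.map_id]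

/-- The comparison between placing a direct sum in degree `k` and summing the placed objects. -/
noncomputable def singleBiprodIso (P P' : C) (k : ℤ) :
    (singleFunctor C k).obj P ⊞ (singleFunctor C k).obj P' ≅ (singleFunctor C k).obj (P ⊞ P') :=
  haveI := preservesBinaryBiproducts_of_preservesBiproducts (singleFunctor C k)
  ((singleFunctor C k).mapBiprod P P').symm

variable {𝒬 : ObjectProperty C} {H : Type*} [AddCommGroup H] (f : 𝒬.FullSubcategory → H)

open Classical in
/-- The extension of an invariant `f` of the objects in `𝒬` to the objects of the derived category
which are isomorphic to an object of `𝒬` placed in degree `0`, with the junk value `0` elsewhere. -/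
noncomputable def singleClass (X : DerivedCategory C) : H :=
  if h : ∃ P : 𝒬.FullSubcategory, Nonempty (X ≅ (singleFunctor C 0).obj P.obj) then f h.choose
  else 0

variable {f}

theorem singleClass_eq (hf : IsSplitAdditive f) {Z : 𝒬.FullSubcategory} (hZ : IsZero Z.obj)
    {X : DerivedCategory C} {P : 𝒬.FullSubcategory} (e : X ≅ (singleFunctor C 0).obj P.obj) :
    singleClass f X = f P := by
  have h : ∃ P : 𝒬.FullSubcategory, Nonempty (X ≅ (singleFunctor C 0).obj P.obj) := ⟨P, ⟨e⟩⟩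
  rw [singleClass, dif_pos h]
  exact hf.eq_of_iso hZ ((singleFunctor C 0).preimageIso (h.choose_spec.some.symm ≪≫ e))

end Single

theorem isCompactGenerating_shiftedGenerators
    {C : Type u} [Category.{t} C] [Abelian C] [HasDerivedCategory.{w} C] [HasCoproducts.{t} C]
    {ι : Type t} {G : ι → C} (hG : IsCompactProjGenerating.{t} G) :
    IsCompactGenerating.{t} (shiftedGenerators G) where
  le_isCompactObject := fun X ⟨i, k, ⟨e⟩⟩ => by
    have := hG.projective i
    exact (isCompactObject.{t} _).prop_of_iso e.symm
      (isCompactObject_singleFunctor hG (hG.isCompactObject i) k)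
  isZero := hG.isZero_of_shiftedGenerators
  exists_family X := by
    refine ⟨Σ (i : ι) (k : ℤ),
      (HomologicalComplex.single C (ComplexShape.up ℤ) k).obj (G i) ⟶ Q.objPreimage X,
      fun j => (singleFunctor C j.2.1).obj (G j.1),
      fun j => Q.map j.2.2 ≫ (Q.objObjPreimageIso X).hom,
      fun j => ⟨j.1, j.2.1, ⟨Iso.refl _⟩⟩, ?_⟩
    rintro Z ⟨i, k, ⟨e⟩⟩ f
    have := hG.projective i
    obtain ⟨φ, hφ⟩ := Q_map_surjective
      (K := (HomologicalComplex.single C (ComplexShape.up ℤ) k).obj (G i))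
      (e.inv ≫ f ≫ (Q.objObjPreimageIso X).inv)
    have hf : f = e.hom ≫ (e.inv ≫ f ≫ (Q.objObjPreimageIso X).inv) ≫
        (Q.objObjPreimageIso X).hom := by simp
    exact ⟨⟨i, k, φ⟩, e.hom, hf.trans (congrArg (e.hom ≫ · ≫ _) hφ.symm)⟩

/-- A class of compact projective objects which is closed under finite direct sums and retracts
and contains a family `G` of generators. -/
structure IsCompactProjClass {C : Type*} [Category* C] [Abelian C] {ι : Type*} (G : ι → C)
    (𝒬 : ObjectProperty C) : Prop where
  projective : ∀ {X : C}, 𝒬 X → Projective X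
  isCompact : ∀ {X : C}, 𝒬 X → isCompactObject.{t} C X
  prop_of_isZero : ∀ {X : C}, IsZero X → 𝒬 X
  prop_biprod : ∀ {X Y : C}, 𝒬 X → 𝒬 Y → 𝒬 (X ⊞ Y)
  prop_of_retract : ∀ {X Y : C}, Retract X Y → 𝒬 Y → 𝒬 X
  prop_generator : ∀ i, 𝒬 (G i)
  isZero : ∀ X : C, (∀ i (f : G i ⟶ X), f = 0) → IsZero X

namespace IsCompactProjClass

section

variable {C : Type*} [Category* C] [Abelian C] {ι : Type*} {G : ι → C} {𝒬 : ObjectProperty C}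
  (hQ : IsCompactProjClass.{t} G 𝒬)

include hQ in
theorem isCompactProjGenerating : IsCompactProjGenerating.{t} G where
  projective i := hQ.projective (hQ.prop_generator i)
  isZero := hQ.isZero
  isCompactObject i := hQ.isCompact (hQ.prop_generator i)

variable [HasDerivedCategory.{w} C] {H : Type*} [AddCommGroup H] {f : 𝒬.FullSubcategory → H}

include hQ in
theorem singleClass_eq (hf : IsSplitAdditive f) {X : DerivedCategory C} {P : 𝒬.FullSubcategory}
    (e : X ≅ (singleFunctor C 0).obj P.obj) : singleClass f X = f P :=
  _root_.singleClass_eq hf (Z := ⟨⊥_ C, hQ.prop_of_isZero initialIsInitial.isZero⟩)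
    initialIsInitial.isZero e

/-- The objects of `𝒬`, placed in degree `0`, form a presilting class of the derived category. It
carries the invariant given by a split additive invariant of the objects in `𝒬`. -/
noncomputable def presilting (hf : IsSplitAdditive f) :
    PresiltingInvariant (DerivedCategory C) H where
  P X := ∃ P : 𝒬.FullSubcategory, Nonempty (X ≅ (singleFunctor C 0).obj P.obj)
  cl := singleClass f
  zero := ⟨⟨⊥_ C, hQ.prop_of_isZero initialIsInitial.isZero⟩,
    ⟨(isZero_zero _).iso ((singleFunctor C 0).map_isZero initialIsInitial.isZero)⟩⟩
  biprod := fun ⟨P, ⟨e⟩⟩ ⟨P', ⟨e'⟩⟩ =>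
    ⟨⟨_, hQ.prop_biprod P.property P'.property⟩, ⟨biprod.mapIso e e' ≪≫ singleBiprodIso _ _ _⟩⟩
  retract := fun r ⟨P, ⟨e⟩⟩ => by
    obtain ⟨P', r', e'⟩ := exists_iso_single_of_retract (r.trans e.retract)
    exact ⟨⟨P', hQ.prop_of_retract r' P.property⟩, e'⟩
  cl_iso := fun e ⟨P, ⟨e'⟩⟩ => by
    rw [hQ.singleClass_eq hf e', hQ.singleClass_eq hf (e.symm ≪≫ e')]
  cl_biprod := fun ⟨P, ⟨e⟩⟩ ⟨P', ⟨e'⟩⟩ => by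
    rw [hQ.singleClass_eq hf e, hQ.singleClass_eq hf e', hQ.singleClass_eq hf
      (P := ⟨_, hQ.prop_biprod P.property P'.property⟩)
      (biprod.mapIso e e' ≪≫ singleBiprodIso _ _ _)]
    exact hf _ _ _ ⟨Iso.refl _⟩
  hom_eq_zero := fun ⟨P, ⟨e⟩⟩ ⟨P', ⟨e'⟩⟩ k hk φ => by
    have := hQ.projective P.property
    let e'' := (shiftFunctor _ k).mapIso e' ≪≫
      ((singleFunctors C).shiftIso k (-k) 0 (by lia)).app P'.obj
    have h : e.inv ≫ φ ≫ e''.hom = 0 := single_hom_eq_zero (show (0 : ℤ) ≠ -k by lia) _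
    rw [← cancel_epi e.inv, ← cancel_mono e''.hom, Category.assoc, h, comp_zero, zero_comp]

theorem hasEulerChar_single (hf : IsSplitAdditive f) {X : DerivedCategory C} {P : 𝒬.FullSubcategory}
    (e : X ≅ (singleFunctor C 0).obj P.obj) : (hQ.presilting hf).HasEulerChar X (f P) := by
  rw [← hQ.singleClass_eq hf e]
  exact .of_prop ⟨P, ⟨e⟩⟩

end

variable {C : Type u} [Category.{t} C] [Abelian C] [HasCoproducts.{t} C] {ι : Type t} {G : ι → C}
  {𝒬 : ObjectProperty C} (hQ : IsCompactProjClass.{t} G 𝒬) [HasDerivedCategory.{w} C]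

include hQ in
theorem isCompactObject_single (P : 𝒬.FullSubcategory) :
    isCompactObject.{t} (DerivedCategory C) ((singleFunctor C 0).obj P.obj) :=
  have := hQ.projective P.property
  isCompactObject_singleFunctor hQ.isCompactProjGenerating (hQ.isCompact P.property) 0

variable [Nonempty ι] {H : Type*} [AddCommGroup H] {f : 𝒬.FullSubcategory → H}
  (hf : IsSplitAdditive f)

theorem isCompactObject_le_resolvable :
    isCompactObject.{t} (DerivedCategory C) ≤ (hQ.presilting hf).resolvable := by
  have := hQ.isCompactProjGenerating.hasCoproducts
  rw [(isCompactGenerating_shiftedGenerators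
    hQ.isCompactProjGenerating).isCompactObject_eq_triangEnvelope]
  refine (shiftedGenerators G).triangEnvelope_le_iff.2 fun X ⟨i, k, ⟨e⟩⟩ => ?_
  have hi : (hQ.presilting hf).resolvable ((singleFunctor C 0).obj (G i)) :=
    le_resolvable _ _ ⟨⟨_, hQ.prop_generator i⟩, ⟨Iso.refl _⟩⟩
  exact ObjectProperty.prop_of_iso _
    (((singleFunctors C).shiftIso (-k) k 0 (by lia)).app (G i) ≪≫ e.symm)
    (ObjectProperty.le_shift _ (-k) _ hi)

/-- The Euler characteristic `∑ (-1)ⁱ f(Pⁱ)` of the compact objects of the derived category. -/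
noncomputable def eulerChar (M : (isCompactObject.{t} (DerivedCategory C)).FullSubcategory) :
    H :=
  PresiltingInvariant.eulerChar (hQ.isCompactObject_le_resolvable hf _ M.property)

theorem hasEulerChar_eulerChar
    (M : (isCompactObject.{t} (DerivedCategory C)).FullSubcategory) :
    (hQ.presilting hf).HasEulerChar M.obj (hQ.eulerChar hf M) :=
  PresiltingInvariant.hasEulerChar_eulerChar _

theorem isTriangleAdditive_eulerChar : IsTriangleAdditive (hQ.eulerChar hf) :=
  PresiltingInvariant.isTriangleAdditive_eulerChar (hQ.isCompactObject_le_resolvable hf)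

theorem eulerChar_single (P : 𝒬.FullSubcategory) :
    hQ.eulerChar hf ⟨_, hQ.isCompactObject_single P⟩ = f P :=
  (hQ.hasEulerChar_eulerChar hf _).unique (hQ.hasEulerChar_single hf (Iso.refl _))

theorem eq_map_eulerChar {K : Type*} [AddCommGroup K]
    {κ : (isCompactObject.{t} (DerivedCategory C)).FullSubcategory → K}
    (hκ : IsTriangleAdditive κ) (Φ : H →+ K)
    (hΦ : ∀ P, κ ⟨_, hQ.isCompactObject_single P⟩ = Φ (f P))
    (M : (isCompactObject.{t} (DerivedCategory C)).FullSubcategory) :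
    κ M = Φ (hQ.eulerChar hf M) := by
  refine hκ.eq_of_hasEulerChar ?_ (hQ.hasEulerChar_eulerChar hf M) M.property
  rintro X ⟨P, ⟨e⟩⟩
  have hX := (isCompactObject.{t} (DerivedCategory C)).prop_of_iso e.symm
    (hQ.isCompactObject_single P)
  exact ⟨hX, (hκ.eq_of_iso (Y := ⟨_, hQ.isCompactObject_single P⟩) e).trans
    ((hΦ P).trans (congrArg Φ (hQ.singleClass_eq hf e).symm))⟩

end IsCompactProjClass

end CompactProjClass

section GrothendieckGroupIso

open DerivedCategory

section PresentedClass

variable {R : Type} [Ring R]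

theorem isSplitAdditive_presentedClass {C : Type*} [Category* C] [Preadditive C]
    [HasBinaryBiproducts C] {P : ObjectProperty C} {U : Set (P.FullSubcategory →₀ R)}
    (hU : directSumRelations R P ⊆ U) : IsSplitAdditive (presentedClass U) :=
  (isSplitAdditive_iff R).2 fun _ hr => linearCombination_presentedClass_eq_zero (hU hr)

theorem isTriangleAdditive_presentedClass {D : Type*} [Category* D] [Preadditive D]
    [HasZeroObject D] [HasShift D ℤ] [∀ n : ℤ, (shiftFunctor D n).Additive] [Pretriangulated D]
    {P : ObjectProperty D} {V : Set (P.FullSubcategory →₀ R)} (hV : triangleRelations R P ⊆ V) :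
    IsTriangleAdditive (presentedClass V) :=
  (isTriangleAdditive_iff R).2 fun _ hr => linearCombination_presentedClass_eq_zero (hV hr)

theorem isShiftEquivariant_presentedClass {C : Type*} [Category* C] {P : ObjectProperty C}
    {S : ℤ → C ⥤ C} {U : Set (P.FullSubcategory →₀ ℤ[T;T⁻¹])} (hU : shiftRelations P S ⊆ U) :
    IsShiftEquivariant S (presentedClass U) :=
  isShiftEquivariant_iff.2 fun _ hr => linearCombination_presentedClass_eq_zero (hU hr)

end PresentedClass

namespace IsCompactProjClass

section

variable {C : Type u} [Category.{t} C] [Abelian C] [HasCoproducts.{t} C] {ι : Type t} {G : ι → C}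
  {𝒬 : ObjectProperty C} (hQ : IsCompactProjClass.{t} G 𝒬) [HasDerivedCategory.{w} C]
  {R : Type} [Ring R]
  {K : Type*} [AddCommGroup K]
  {κ : (isCompactObject.{t} (DerivedCategory C)).FullSubcategory → K}

theorem isSplitAdditive_comp_single (hκ : IsTriangleAdditive κ) :
    IsSplitAdditive fun P : 𝒬.FullSubcategory => κ ⟨_, hQ.isCompactObject_single P⟩ :=
  hκ.isSplitAdditive (singleFunctor C 0) hQ.isCompactObject_single

variable [Nonempty ι]

/-- The two maps are `[P] ↦ [P]` and the Euler characteristic. -/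
theorem exists_linearEquiv {U : Set (𝒬.FullSubcategory →₀ R)}
    {V : Set ((isCompactObject.{t} (DerivedCategory C)).FullSubcategory →₀ R)}
    (hU : directSumRelations R 𝒬 ⊆ U) (hV : triangleRelations R _ ⊆ V)
    (hUV : ∀ r ∈ U, Finsupp.linearCombination R
      (fun P => presentedClass V ⟨_, hQ.isCompactObject_single P⟩) r = 0)
    (hVU : ∀ r ∈ V, Finsupp.linearCombination R
      (hQ.eulerChar (isSplitAdditive_presentedClass hU)) r = 0) :
    ∃ e : ((𝒬.FullSubcategory →₀ R) ⧸ Submodule.span R U) ≃ₗ[R] _ ⧸ Submodule.span R V,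
      ∀ P, e (presentedClass U P) = presentedClass V ⟨_, hQ.isCompactObject_single P⟩ := by
  let Φ := presentedLift _ hUV
  have hΦ (P) : Φ (presentedClass U P) = presentedClass V ⟨_, hQ.isCompactObject_single P⟩ :=
    presentedLift_presentedClass _ hUV P
  refine ⟨.ofLinearMap Φ (presentedLift _ hVU) (presented_hom_ext fun M => ?_)
    (presented_hom_ext fun P => ?_), hΦ⟩
  · refine (congrArg Φ (presentedLift_presentedClass _ hVU M)).trans ?_
    exact (hQ.eq_map_eulerChar _ (isTriangleAdditive_presentedClass hV) Φ.toAddMonoidHom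
      (fun P => (hΦ P).symm) M).symm
  · refine (congrArg _ (hΦ P)).trans ?_
    exact (presentedLift_presentedClass _ hVU _).trans (hQ.eulerChar_single _ P)

theorem exists_linearEquiv_triangleRelations :
    ∃ e : ((𝒬.FullSubcategory →₀ R) ⧸ Submodule.span R (directSumRelations R 𝒬)) ≃ₗ[R]
        _ ⧸ Submodule.span R (triangleRelations R (isCompactObject.{t} (DerivedCategory C))),
      ∀ P, e (presentedClass _ P) = presentedClass _ ⟨_, hQ.isCompactObject_single P⟩ :=
  hQ.exists_linearEquiv subset_rfl subset_rfl
    ((isSplitAdditive_iff R).1 <| hQ.isSplitAdditive_comp_single <|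
      isTriangleAdditive_presentedClass subset_rfl)
    ((isTriangleAdditive_iff R).1 (hQ.isTriangleAdditive_eulerChar _))

end

section Shift

variable {C : Type u} [Category.{t} C] [Abelian C] [HasCoproducts.{t} C] {ι : Type t} {G : ι → C}
  {𝒬 : ObjectProperty C} (hQ : IsCompactProjClass.{t} G 𝒬) [HasDerivedCategory.{w} C]
  {S : ℤ → C ⥤ C} [∀ n, (S n).Additive] [∀ n, PreservesFiniteLimits (S n)]
  [∀ n, PreservesFiniteColimits (S n)]

theorem isShiftEquivariant_comp_single {K : Type*} [AddCommGroup K] [Module ℤ[T;T⁻¹] K]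
    {κ : (isCompactObject.{t} (DerivedCategory C)).FullSubcategory → K}
    (hκ : IsShiftEquivariant (fun n => (S n).mapDerivedCategory) κ) :
    IsShiftEquivariant S fun P : 𝒬.FullSubcategory => κ ⟨_, hQ.isCompactObject_single P⟩ :=
  fun n X _ ⟨e⟩ => hκ n _ _ ⟨(singleFunctor C 0).mapIso e ≪≫
    (((S n).mapDerivedCategorySingleFunctor 0).app X.obj).symm⟩

variable [Nonempty ι] (hS : ∀ n X, 𝒬 X → 𝒬 ((S n).obj X))

include hS

theorem isShiftEquivariant_eulerChar {H : Type*} [AddCommGroup H] [Module ℤ[T;T⁻¹] H]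
    {f : 𝒬.FullSubcategory → H} (hf : IsSplitAdditive f) (hf' : IsShiftEquivariant S f) :
    IsShiftEquivariant (fun n => (S n).mapDerivedCategory) (hQ.eulerChar hf) := by
  intro n X Y ⟨e⟩
  have hsingle {Z : DerivedCategory C} (P : 𝒬.FullSubcategory)
      (e : Z ≅ (singleFunctor C 0).obj P.obj) :
      Nonempty ((S n).mapDerivedCategory.obj Z ≅ (singleFunctor C 0).obj ((S n).obj P.obj)) :=
    ⟨(S n).mapDerivedCategory.mapIso e ≪≫ ((S n).mapDerivedCategorySingleFunctor 0).app P.obj⟩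
  refine (hQ.hasEulerChar_eulerChar hf Y).unique (((hQ.hasEulerChar_eulerChar hf X).map
    (S n).mapDerivedCategory
    (DistribSMul.toAddMonoidHom H (LaurentPolynomial.T n : ℤ[T;T⁻¹])) ?_ ?_).of_iso e.symm)
  · exact fun Z ⟨P, ⟨e⟩⟩ => ⟨⟨_, hS n _ P.property⟩, hsingle P e⟩
  · rintro Z ⟨P, ⟨e⟩⟩
    obtain ⟨e'⟩ := hsingle P e
    have hZ : singleClass f Z = f P := hQ.singleClass_eq hf e
    exact (hQ.singleClass_eq hf (P := ⟨_, hS n _ P.property⟩) e').trans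
      ((hf' n P _ ⟨Iso.refl _⟩).trans (congrArg _ hZ.symm))

theorem exists_linearEquiv_shiftRelations :
    ∃ e : ((𝒬.FullSubcategory →₀ ℤ[T;T⁻¹]) ⧸ Submodule.span ℤ[T;T⁻¹]
          (directSumRelations ℤ[T;T⁻¹] 𝒬 ∪ shiftRelations 𝒬 S)) ≃ₗ[ℤ[T;T⁻¹]]
        _ ⧸ Submodule.span ℤ[T;T⁻¹]
          (triangleRelations ℤ[T;T⁻¹] (isCompactObject.{t} (DerivedCategory C)) ∪
            shiftRelations _ fun n => (S n).mapDerivedCategory),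
      ∀ P, e (presentedClass _ P) = presentedClass _ ⟨_, hQ.isCompactObject_single P⟩ := by
  refine hQ.exists_linearEquiv Set.subset_union_left Set.subset_union_left ?_ ?_
  · rintro r (hr | hr)
    · exact (isSplitAdditive_iff _).1 (hQ.isSplitAdditive_comp_single
        (isTriangleAdditive_presentedClass Set.subset_union_left)) r hr
    · exact isShiftEquivariant_iff.1 (hQ.isShiftEquivariant_comp_single
        (isShiftEquivariant_presentedClass Set.subset_union_right)) r hr
  · rintro r (hr | hr)
    · exact (isTriangleAdditive_iff _).1 (hQ.isTriangleAdditive_eulerChar _) r hr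
    · exact isShiftEquivariant_iff.1 (hQ.isShiftEquivariant_eulerChar hS _
        (isShiftEquivariant_presentedClass Set.subset_union_right)) r hr

end Shift

end IsCompactProjClass

end GrothendieckGroupIso

section FinitelyGeneratedModules

theorem finite_and_projective_of_retract {A M M' : Type*} [Ring A] [AddCommGroup M] [Module A M]
    [AddCommGroup M'] [Module A M'] [Module.Finite A M'] [Module.Projective A M'] (i : M →ₗ[A] M')
    (r : M' →ₗ[A] M) (h : r ∘ₗ i = LinearMap.id) : Module.Finite A M ∧ Module.Projective A M :=
  ⟨Module.Finite.of_surjective r fun x => ⟨i x, LinearMap.congr_fun h x⟩,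
    Module.Projective.of_split i r h⟩

theorem finite_and_projective_of_subsingleton (A M : Type*) [Ring A] [AddCommGroup M] [Module A M]
    [Subsingleton M] : Module.Finite A M ∧ Module.Projective A M :=
  have : Module.Free A M := Module.Free.of_subsingleton A M
  ⟨inferInstance, Module.Projective.of_free⟩

variable {A : Type u} [Ring A]

theorem exists_coprodIdem_hom_apply {J : Type*} {N : J → ModuleCat.{u} A} {c : Cofan N}
    (hc : IsColimit c) (x : c.pt) :
    ∃ T : Finset J, ∀ T', T ⊆ T' → (coprodIdem hc T').hom x = x := by
  classical
  -- Such elements form a submodule which contains all summands, so the quotient by it vanishes.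
  let S : Submodule A c.pt :=
    { carrier := {x | ∃ T : Finset J, ∀ T', T ⊆ T' → (coprodIdem hc T').hom x = x}
      zero_mem' := ⟨∅, fun _ _ => map_zero _⟩
      add_mem' := by
        rintro x y ⟨T, hx⟩ ⟨T', hy⟩
        exact ⟨T ∪ T', fun U hU => by
          rw [map_add, hx U (Finset.union_subset_left hU), hy U (Finset.union_subset_right hU)]⟩
      smul_mem' := by
        rintro a x ⟨T, hx⟩
        exact ⟨T, fun U hU => by rw [map_smul, hx U hU]⟩ }
  have hS : ModuleCat.ofHom S.mkQ = 0 := Cofan.IsColimit.hom_ext hc _ _ fun j => by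
    ext y
    refine (Submodule.Quotient.mk_eq_zero S).2 ⟨{j}, fun U hU => ?_⟩
    exact congrArg (fun f => f.hom y) (inj_coprodIdem hc (Finset.singleton_subset_iff.1 hU))
  exact (Submodule.Quotient.mk_eq_zero S).1 (congrArg (fun f => f.hom x) hS)

theorem isCompactObject_of_moduleFinite (M : ModuleCat.{u} A) [Module.Finite A M] :
    isCompactObject.{t} (ModuleCat.{u} A) M :=
  isCompactObject_iff.2 fun J N c hc f => by
    classical
    obtain ⟨s, hs⟩ := Module.Finite.fg_top (R := A) (M := M)
    choose T hT using fun m => exists_coprodIdem_hom_apply hc (f.hom m)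
    refine ⟨s.biUnion T, ModuleCat.hom_ext (LinearMap.ext_on hs fun m hm => ?_)⟩
    exact hT m _ (Finset.subset_biUnion_of_mem T hm)

variable (A) in
theorem isCompactProjClass_fgProjective :
    IsCompactProjClass.{u} (fun _ : PUnit.{u + 1} => ModuleCat.of A A) (fgProjective A) where
  projective {X} hX := (IsProjective.iff_projective X).1 hX.2
  isCompact {X} hX := by
    have := hX.1
    exact isCompactObject_of_moduleFinite X
  prop_of_isZero {X} hX := by
    have := ModuleCat.subsingleton_of_isZero hX
    exact finite_and_projective_of_subsingleton A X
  prop_biprod {X Y} := by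
    rintro ⟨_, _⟩ ⟨_, _⟩
    exact finite_and_projective_of_retract
      ((biprod.fst : X ⊞ Y ⟶ X).hom.prod (biprod.snd : X ⊞ Y ⟶ Y).hom)
      ((biprod.inl : X ⟶ X ⊞ Y).hom.coprod (biprod.inr : Y ⟶ X ⊞ Y).hom)
      (congrArg ModuleCat.Hom.hom (biprod.total (X := X) (Y := Y)))
  prop_of_retract r := by
    rintro ⟨_, _⟩
    exact finite_and_projective_of_retract r.i.hom r.r.hom (congrArg ModuleCat.Hom.hom r.retract)
  prop_generator _ := ⟨inferInstanceAs (Module.Finite A A), inferInstanceAs (Module.Projective A A)⟩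
  isZero X hX := by
    rw [IsZero.iff_id_eq_zero]
    ext x
    have h : (1 : A) • x = 0 := congrArg (fun f => f.hom (1 : A))
      (hX ⟨⟩ (ModuleCat.ofHom (LinearMap.toSpanSingleton A X x)))
    rwa [one_smul] at h

end FinitelyGeneratedModules

namespace GrMod

variable {A : Type u} [Ring A] {𝒜 : ℤ → AddSubgroup A}

section DirectSums

open DirectSum

variable {J : Type u} (N : J → GrMod 𝒜)

open Classical in
theorem of_mem_gr {i : ℤ} {j : J} {m : (N j).carrier} (hm : m ∈ (N j).gr i) (k : J) :
    DirectSum.of (fun j => (N j).carrier) j m k ∈ (N k).gr i := by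
  obtain rfl | hkj := eq_or_ne k j
  · rwa [of_eq_same]
  · rw [of_eq_of_ne _ _ _ hkj]
    exact zero_mem _

open Classical in
/-- The direct sum of a family of graded modules, an element being homogeneous of degree `i` if
all its components are. -/
noncomputable def dsum : GrMod 𝒜 where
  carrier := ⨁ j, (N j).carrier
  gr i :=
    { carrier := {x | ∀ j, x j ∈ (N j).gr i}
      zero_mem' := fun j => zero_mem _
      add_mem' := fun hx hy j => add_mem (hx j) (hy j)
      neg_mem' := fun hx j => neg_mem (hx j) }
  isInternal := by
    refine isInternal_of_proj _ (fun i => DFinsupp.mapRange.addMonoidHom fun j => (N j).proj i)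
      (fun i x hx => DFinsupp.ext fun j => (N j).proj_of_mem (hx j))
      (fun i k hik x hx => DFinsupp.ext fun j => (N j).proj_of_mem_ne hik (hx j)) fun x => ?_
    induction x using DirectSum.induction_on with
    | zero => exact zero_mem _
    | of j m =>
      induction m using (N j).induction_gr with
      | h0 => rw [map_zero]; exact zero_mem _
      | h i m hm => exact AddSubgroup.mem_iSup_of_mem i (of_mem_gr N hm)
      | ha a b ha hb => rw [map_add]; exact add_mem ha hb
    | add x y hx hy => exact add_mem hx hy
  smul_mem ha hm j := (N j).smul_mem ha (hm j)

open Classical in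
/-- The inclusion of a summand into a direct sum of graded modules. -/
noncomputable def dsumι (j : J) : N j ⟶ dsum N :=
  ⟨DirectSum.lof A J (fun j => (N j).carrier) j, fun _ _ hm => of_mem_gr N hm⟩

/-- The projection of a direct sum of graded modules onto a summand. -/
noncomputable def dsumProj (j : J) : dsum N ⟶ N j :=
  ⟨DirectSum.component A J (fun j => (N j).carrier) j, fun _ _ hx => hx j⟩

variable {N}

theorem exists_sum_dsumι_eq (x : (dsum N).carrier) :
    ∃ T : Finset J, ∀ T', T ⊆ T' → ∑ j ∈ T', (dsumι N j).lin ((dsumProj N j).lin x) = x := by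
  classical
  refine ⟨DFinsupp.support (β := fun j => (N j).carrier) x, fun T' hT' => ?_⟩
  refine Eq.trans (Finset.sum_subset hT' fun j _ hj => ?_).symm
    (DirectSum.sum_support_of (β := fun j => (N j).carrier) x)
  have hx : (dsumProj N j).lin x = 0 := DFinsupp.notMem_support_iff.1 hj
  rw [hx, map_zero]

variable {M : GrMod 𝒜}

open Classical in
/-- The linear map underlying `dsumDesc`. -/
noncomputable def dsumLin (f : ∀ j, N j ⟶ M) : (dsum N).carrier →ₗ[A] M.carrier :=
  DirectSum.toModule A J M.carrier fun j => (f j).lin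

theorem dsumLin_dsumι (f : ∀ j, N j ⟶ M) (j : J) (m : (N j).carrier) :
    dsumLin f ((dsumι N j).lin m) = (f j).lin m := by
  classical
  exact DirectSum.toModule_lof (M := fun j => (N j).carrier) (φ := fun j => (f j).lin) A j m

/-- The morphism out of a direct sum of graded modules with given restrictions to the summands. -/
noncomputable def dsumDesc (f : ∀ j, N j ⟶ M) : dsum N ⟶ M where
  lin := dsumLin f
  map_mem i x hx := by
    obtain ⟨T, hT⟩ := exists_sum_dsumι_eq x
    rw [← hT T subset_rfl, map_sum]
    refine sum_mem fun j _ => ?_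
    rw [dsumLin_dsumι]
    exact (f j).map_mem i _ ((dsumProj N j).map_mem i x hx)

theorem dsumι_dsumDesc (f : ∀ j, N j ⟶ M) (j : J) : dsumι N j ≫ dsumDesc f = f j :=
  GrMod.hom_ext fun m => dsumLin_dsumι f j m

theorem dsum_hom_ext {f g : dsum N ⟶ M} (h : ∀ j, dsumι N j ≫ f = dsumι N j ≫ g) : f = g := by
  ext x
  obtain ⟨T, hT⟩ := exists_sum_dsumι_eq x
  rw [← hT T subset_rfl, map_sum, map_sum]
  exact Finset.sum_congr rfl fun j _ => LinearMap.congr_fun (congrArg Hom.lin (h j)) _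

variable (N) in
/-- The direct sum of a family of graded modules is its coproduct. -/
noncomputable def dsumIsColimit : IsColimit (Cofan.mk (dsum N) (dsumι N)) :=
  Cofan.IsColimit.mk _ (fun s => dsumDesc s.inj) (fun s j => dsumι_dsumDesc s.inj j) fun s _ hm =>
    dsum_hom_ext fun j => (hm j).trans (dsumι_dsumDesc s.inj j).symm

instance : HasCoproducts.{u} (GrMod 𝒜) :=
  hasCoproducts_of_colimit_cofans (fun N => Cofan.mk (dsum N) (dsumι N)) fun N => dsumIsColimit N

theorem sum_lin {M' : GrMod 𝒜} (T : Finset J) (f : J → (M ⟶ M')) (m : M.carrier) :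
    (∑ j ∈ T, f j).lin m = ∑ j ∈ T, (f j).lin m :=
  map_sum (AddMonoidHom.mk' (fun g : M ⟶ M' => g.lin m) fun _ _ => rfl) f T

theorem isCompactObject_of_finite (M : GrMod 𝒜) [Module.Finite A M.carrier] :
    isCompactObject.{u} (GrMod 𝒜) M :=
  isCompactObject_iff.2 fun J N c hc f => by
    classical
    let φ := hc.coconePointUniqueUpToIso (dsumIsColimit N)
    have hφ (j : J) : dsumι N j ≫ φ.inv = c.inj j :=
      hc.comp_coconePointUniqueUpToIso_inv (dsumIsColimit N) ⟨j⟩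
    obtain ⟨s, hs⟩ := Module.Finite.fg_top (R := A) (M := M.carrier)
    choose T hT using fun m => exists_sum_dsumι_eq ((f ≫ φ.hom).lin m)
    have hf : f ≫ φ.hom = ∑ j ∈ s.biUnion T, (f ≫ φ.hom ≫ dsumProj N j) ≫ dsumι N j := by
      refine Hom.ext (LinearMap.ext_on hs fun m hm => ?_)
      rw [sum_lin]
      exact (hT m _ (Finset.subset_biUnion_of_mem T hm)).symm
    refine ⟨s.biUnion T, comp_coprodIdem_of_eq_sum hc (g := fun j => f ≫ φ.hom ≫ dsumProj N j) ?_⟩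
    refine (φ.comp_inv_eq.2 rfl : (f ≫ φ.hom) ≫ φ.inv = f).symm.trans ?_
    rw [hf, Preadditive.sum_comp]
    exact Finset.sum_congr rfl fun j _ => (Category.assoc _ _ _).trans (congrArg _ (hφ j))

end DirectSums

section Projective

variable {P M : GrMod 𝒜}

theorem exists_addMonoidHom_eq_on_gr {B : Type*} [AddCommGroup B] (P : GrMod 𝒜)
    (f : ∀ i, P.gr i →+ B) : ∃ g : P.carrier →+ B, ∀ i (p : P.gr i), g p = f i p := by
  let e := AddEquiv.ofBijective (DirectSum.coeAddMonoidHom P.gr) P.isInternal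
  refine ⟨(DirectSum.toAddMonoid f).comp e.symm.toAddMonoidHom, fun i p => ?_⟩
  have hp : e.symm p = DirectSum.of _ i p :=
    e.symm_apply_eq.2 (DirectSum.coeAddMonoidHom_of P.gr i p).symm
  exact (congrArg (DirectSum.toAddMonoid f) hp).trans (DirectSum.toAddMonoid_of f i p)

theorem proj_smul (M : GrMod 𝒜) {i : ℤ} {a : A} (ha : a ∈ 𝒜 i) (j : ℤ) (m : M.carrier) :
    M.proj (i + j) (a • m) = a • M.proj j m := by
  induction m using M.induction_gr with
  | h0 => rw [smul_zero, map_zero, map_zero, smul_zero]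
  | h k m hm =>
    obtain rfl | hjk := eq_or_ne j k
    · rw [M.proj_of_mem hm, M.proj_of_mem (M.smul_mem ha hm)]
    · rw [M.proj_of_mem_ne hjk hm, M.proj_of_mem_ne (by lia) (M.smul_mem ha hm), smul_zero]
  | ha x y hx hy => rw [smul_add, map_add, hx, hy, map_add, smul_add]

variable [GradedRing 𝒜]

theorem map_smul_of_map_smul_gr (l : P.carrier →+ M.carrier)
    (hl : ∀ i, ∀ a ∈ 𝒜 i, ∀ j, ∀ p ∈ P.gr j, l (a • p) = a • l p) (a : A) (p : P.carrier) :
    l (a • p) = a • l p := by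
  induction a using DirectSum.Decomposition.inductionOn 𝒜 with
  | zero => rw [zero_smul, zero_smul, map_zero]
  | @homogeneous i a =>
    induction p using P.induction_gr with
    | h0 => rw [smul_zero, map_zero, smul_zero]
    | h j p hp => exact hl i a a.2 j p hp
    | ha x y hx hy => rw [smul_add, map_add, hx, hy, map_add, smul_add]
  | add a b ha hb => rw [add_smul, add_smul, map_add, ha, hb]

theorem exists_hom_lin_eq_proj (l : P.carrier →ₗ[A] M.carrier) :
    ∃ f : P ⟶ M, ∀ i, ∀ p ∈ P.gr i, f.lin p = M.proj i (l p) := by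
  obtain ⟨g, hg⟩ := exists_addMonoidHom_eq_on_gr P fun i =>
    (M.proj i).comp (l.toAddMonoidHom.comp (P.gr i).subtype)
  replace hg (i : ℤ) (p : P.carrier) (hp : p ∈ P.gr i) : g p = M.proj i (l p) := hg i ⟨p, hp⟩
  have hsmul := map_smul_of_map_smul_gr g fun i a ha j p hp => by
    rw [hg _ _ hp, hg _ _ (P.smul_mem ha hp), map_smul, M.proj_smul ha]
  refine ⟨⟨{ g with map_smul' := hsmul }, fun i p hp => ?_⟩, hg⟩
  have hgp : g p ∈ M.gr i := hg i p hp ▸ M.proj_mem i (l p)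
  exact hgp

theorem projective_of_projective (P : GrMod 𝒜) [Module.Projective A P.carrier] : Projective P where
  factors {E X} f e he := by
    obtain ⟨l, hl⟩ := Module.projective_lifting_property e.lin f.lin (surjective_of_epi e)
    obtain ⟨g, hg⟩ := exists_hom_lin_eq_proj (M := E) l
    refine ⟨g, GrMod.hom_ext fun p => ?_⟩
    induction p using P.induction_gr with
    | h0 => rw [map_zero, map_zero]
    | h i p hp =>
      calc
        e.lin (g.lin p) = X.proj i (e.lin (l p)) := by rw [hg i p hp, proj_naturality]
        _ = X.proj i (f.lin p) := congrArg (X.proj i) (LinearMap.congr_fun hl p)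
        _ = f.lin p := X.proj_of_mem (f.map_mem i p hp)
    | ha x y hx hy => rw [map_add, map_add, hx, hy]

end Projective

section Generators

variable (𝒜) [GradedRing 𝒜]

/-- The graded ring as a graded left module over itself. -/
def regular : GrMod 𝒜 where
  carrier := A
  gr := 𝒜
  isInternal := DirectSum.Decomposition.isInternal 𝒜
  smul_mem ha hm := SetLike.mul_mem_graded ha hm

variable {𝒜}

/-- The morphism `a ↦ a • m` from a shifted regular module given by a homogeneous element `m`. -/
def ofElem (M : GrMod 𝒜) {n : ℤ} {m : M.carrier} (hm : m ∈ M.gr n) :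
    (shift 𝒜 n).obj (regular 𝒜) ⟶ M where
  lin := LinearMap.toSpanSingleton A M.carrier m
  map_mem i (a : A) (ha : a ∈ 𝒜 (i - n)) := by
    have h : a • m ∈ M.gr (i - n + n) := M.smul_mem ha hm
    rwa [sub_add_cancel] at h

theorem isZero_of_forall_regular_hom_eq_zero (X : GrMod 𝒜)
    (hX : ∀ (n : ℤ) (f : (shift 𝒜 n).obj (regular 𝒜) ⟶ X), f = 0) : IsZero X := by
  rw [IsZero.iff_id_eq_zero]
  refine GrMod.hom_ext fun x => ?_
  change x = 0
  induction x using X.induction_gr with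
  | h0 => rfl
  | h i m hm =>
    have h : (1 : A) • m = 0 := LinearMap.congr_fun (congrArg Hom.lin (hX i (X.ofElem hm))) (1 : A)
    rwa [one_smul] at h
  | ha a b ha hb => rw [ha, hb, add_zero]

variable (𝒜) in
theorem isCompactProjClass_grFgProjective :
    IsCompactProjClass.{u} (fun n : ULift.{u} ℤ => (shift 𝒜 n.down).obj (regular 𝒜))
      (grFgProjective 𝒜) where
  projective {X} hX := by
    have := hX.2
    exact projective_of_projective X
  isCompact {X} hX := by
    have := hX.1
    exact isCompactObject_of_finite X
  prop_of_isZero {X} hX := by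
    have h : ∀ x : X.carrier, x = 0 :=
      LinearMap.congr_fun (congrArg Hom.lin ((IsZero.iff_id_eq_zero X).1 hX))
    have : Subsingleton X.carrier := subsingleton_of_forall_eq 0 h
    exact finite_and_projective_of_subsingleton A X.carrier
  prop_biprod {X Y} := by
    rintro ⟨_, _⟩ ⟨_, _⟩
    exact finite_and_projective_of_retract
      ((biprod.fst : X ⊞ Y ⟶ X).lin.prod (biprod.snd : X ⊞ Y ⟶ Y).lin)
      ((biprod.inl : X ⟶ X ⊞ Y).lin.coprod (biprod.inr : Y ⟶ X ⊞ Y).lin)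
      (congrArg Hom.lin (biprod.total (X := X) (Y := Y)))
  prop_of_retract r := by
    rintro ⟨_, _⟩
    exact finite_and_projective_of_retract r.i.lin r.r.lin (congrArg Hom.lin r.retract)
  prop_generator _ := ⟨inferInstanceAs (Module.Finite A A), inferInstanceAs (Module.Projective A A)⟩
  isZero X hX := isZero_of_forall_regular_hom_eq_zero X fun n => hX ⟨n⟩

end Generators

end GrMod

theorem mainTheorem6_general :
    (∀ (A : Type u) [Ring A] [HasDerivedCategory.{w} (ModuleCat.{u} A)],
      ∃ (hc : ∀ P : (fgProjective A).FullSubcategory,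
          compactDg A ((DerivedCategory.singleFunctor (ModuleCat.{u} A) 0).obj P.obj))
        (e : ClassicalK0 A ≃+ DgK0 A),
        ∀ P : (fgProjective A).FullSubcategory,
          e (ClassicalK0.mk A P) = DgK0.mk A ⟨_, hc P⟩) ∧
    (∀ (A : Type u) [Ring A] (𝒜 : ℤ → AddSubgroup A) [GradedRing 𝒜]
      [HasDerivedCategory.{w} (GrMod 𝒜)],
      ∃ (hc : ∀ P : (grFgProjective 𝒜).FullSubcategory,
          compactGrDg 𝒜 ((DerivedCategory.singleFunctor (GrMod 𝒜) 0).obj P.obj))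
        (e : GrClassicalK0 𝒜 ≃ₗ[ℤ[T;T⁻¹]] GrDgK0 𝒜),
        ∀ P : (grFgProjective 𝒜).FullSubcategory,
          e (GrClassicalK0.mk 𝒜 P) = GrDgK0.mk 𝒜 ⟨_, hc P⟩) := by
  constructor
  · intro A _ _
    have hQ := isCompactProjClass_fgProjective A
    obtain ⟨e, he⟩ := hQ.exists_linearEquiv_triangleRelations (R := ℤ)
    exact ⟨hQ.isCompactObject_single, e.toAddEquiv, he⟩
  · intro A _ 𝒜 _ _
    have hQ := GrMod.isCompactProjClass_grFgProjective 𝒜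
    -- The shift leaves the underlying module unchanged.
    obtain ⟨e, he⟩ := hQ.exists_linearEquiv_shiftRelations (S := GrMod.shift 𝒜) fun _ _ hP => hP
    exact ⟨hQ.isCompactObject_single, e, he⟩

theorem mainTheorem6 :
    -- the ungraded case
    (∀ (A : Type u) [Ring A] [IsNoetherianRing A] [HasDerivedCategory.{w} (ModuleCat.{u} A)],
      ∃ (hc : ∀ P : (fgProjective A).FullSubcategory,
          compactDg A ((DerivedCategory.singleFunctor (ModuleCat.{u} A) 0).obj P.obj))
        (e : ClassicalK0 A ≃+ DgK0 A),
        ∀ P : (fgProjective A).FullSubcategory,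
          e (ClassicalK0.mk A P) = DgK0.mk A ⟨_, hc P⟩) ∧
    -- the graded case
    (∀ (A : Type u) [Ring A] (𝒜 : ℤ → AddSubgroup A) [GradedRing 𝒜]
      [HasDerivedCategory.{w} (GrMod 𝒜)], IsGradedNoetherian 𝒜 →
      ∃ (hc : ∀ P : (grFgProjective 𝒜).FullSubcategory,
          compactGrDg 𝒜 ((DerivedCategory.singleFunctor (GrMod 𝒜) 0).obj P.obj))
        (e : GrClassicalK0 𝒜 ≃ₗ[ℤ[T;T⁻¹]] GrDgK0 𝒜),
        ∀ P : (grFgProjective 𝒜).FullSubcategory,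
          e (GrClassicalK0.mk 𝒜 P) = GrDgK0.mk 𝒜 ⟨_, hc P⟩) := by
  exact ⟨fun A _ _ _ => mainTheorem6_general.1 A,
    fun A _ 𝒜 _ _ _ => mainTheorem6_general.2 A 𝒜⟩
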